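/- Let $n\in\mathbb N$ and let $\Gamma=\mathbb Z_2^{*n}$ be the free product of $n$ copies of $\mathbb Z_2$, with standard generators $g_1,\ldots,g_n$, generating set $S=\{g_1,\ldots,g_n\}$ and word length $l$. Let $\widehat\Gamma$ be the spectral triple $(C^*(\Gamma),\ell^2(\Gamma),D)$, where $C^*(\Gamma)$ acts by $g\,\delta_h=\delta_{gh}$ and $D\delta_g=l(g)\delta_g$. Let $G^+(\widehat\Gamma)$ be its quantum isometry group in the sense of Bhowmick and Goswami: among the compact quantum groups $Q$ with a unitary representation $U$ on $\ell^2(\Gamma)$ such that $U$ commutes with $D\otimes 1$ and $(\mathrm{id}\otimes\varphi)(U(a\otimes 1)U^*)\in(\mathbb C\Gamma)''$ for all $a\in\mathbb C\Gamma$ and all states $\varphi$ of $C(Q)$, there is a universal one, and $C(G^+(\widehat\Gamma))$ is its Woronowicz $C^*$-subalgebra generated by the coefficients of the action $\alpha(a)=U(a\otimes 1)U^*$. Let $H_n^+$ be the hyperoctahedral quantum group: $C(H_n^+)$ is the universal unital $C^*$-algebra generated by the entries of an $n\times n$ matrix $u=(u_{ij})$ which is cubic, that is, $u_{ij}=u_{ij}^*$,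 $uu^t=u^tu=1$ and $u_{ij}u_{ik}=u_{ji}u_{ki}=0$ for $j\neq k$, with comultiplication $\Delta(u_{ij})=\sum_k u_{ik}\otimes u_{kj}$. **Proposition 6.1.** $H_n^+$ and $G^+(\widehat{\mathbb Z_2^{*n}})$ exist, and $G^+(\widehat{\mathbb Z_2^{*n}})=H_n^+$. More precisely, $H_n^+$, with an action $\alpha$ on $\mathbb C\Gamma$ satisfying $\alpha(g_i)=\sum_j g_j\otimes u_{ji}$, is the quantum isometry group of $\widehat\Gamma$. Conversely, if $G$ with action $\alpha$ is the quantum isometry group of $\widehat\Gamma$, then $\alpha(g_i)=\sum_j g_j\otimes u_{ji}$ for a matrix $u$ over $C(G)$, and $G$ is $H_n^+$ with matrix of generators $u$; in particular the generators $u_{ij}$ are self-adjoint partial isometries satisfying the cubic relations $u_{ij}u_{ik}=u_{ji}u_{ki}=0$ for $j\neq k$. -/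

import Mathlib

open scoped TensorProduct

universe u

namespace QuantumIsometry

noncomputable section

/-! ### The minimal tensor product of C*-algebras -/

section MinimalTensor

variable {A B H K : Type*} [CStarAlgebra A] [CStarAlgebra B]
  [NormedAddCommGroup H] [InnerProductSpace ℂ H] [CompleteSpace H]
  [NormedAddCommGroup K] [InnerProductSpace ℂ K] [CompleteSpace K]

/-- The tensor product `π ⊗ ρ` of two representations on Hilbert spaces, `a ⊗ b ↦ π a ⊗ ρ b`,
acting on the (algebraic, pre-Hilbert) tensor product of the two spaces by bounded operators. Its
operator norms are those of the extensions to the completed Hilbert space tensor product. -/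
def tensorRep (π : A →⋆ₐ[ℂ] (H →L[ℂ] H)) (ρ : B →⋆ₐ[ℂ] (K →L[ℂ] K)) :
    A ⊗[ℂ] B →ₗ[ℂ] ((H ⊗[ℂ] K) →L[ℂ] (H ⊗[ℂ] K)) :=
  TensorProduct.lift
    (LinearMap.mk₂ ℂ (fun a b => TensorProduct.mapL (π a) (ρ b))
      (fun a a' b => by rw [map_add, TensorProduct.mapL_add_left])
      (fun c a b => by rw [map_smul, TensorProduct.mapL_smul_left])
      (fun a b b' => by rw [map_add, TensorProduct.mapL_add_right])
      (fun c a b => by rw [map_smul, TensorProduct.mapL_smul_right]))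

end MinimalTensor

/-- The values `‖(π ⊗ ρ) x‖`, over all representations `π`, `ρ` on Hilbert spaces, whose supremum is
the minimal (spatial) C*-norm of `x`. -/
def minimalNormValues {A B : Type u} [CStarAlgebra A] [CStarAlgebra B] (x : A ⊗[ℂ] B) : Set ℝ :=
  {r | ∃ (H K : Type u)
      (_ : NormedAddCommGroup H) (_ : InnerProductSpace ℂ H) (_ : CompleteSpace H)
      (_ : NormedAddCommGroup K) (_ : InnerProductSpace ℂ K) (_ : CompleteSpace K)
      (π : A →⋆ₐ[ℂ] (H →L[ℂ] H)) (ρ : B →⋆ₐ[ℂ] (K →L[ℂ] K)), r = ‖tensorRep π ρ x‖}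

/-- `T`, with the map `j` from the algebraic tensor product, is the minimal C*-tensor product of `A`
and `B`: the completion of `A ⊗ B` in the minimal C*-norm. -/
structure IsMinimalTensor {A B T : Type u} [CStarAlgebra A] [CStarAlgebra B] [CStarAlgebra T]
    (j : A ⊗[ℂ] B →⋆ₐ[ℂ] T) : Prop where
  dense : DenseRange j
  norm : ∀ x, IsLUB (minimalNormValues x) ‖j x‖

/-! ### Compact quantum groups -/

/-- For a unital *-homomorphism `Δ : A → A ⊗ A`: the matrix `v` over `A` is an (invertible)
finite-dimensional representation whose conjugate is also invertible, that is
`Δ v_ij = ∑ v_ik ⊗ v_kj`, and `v` and its transpose are invertible. -/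
structure IsFiniteRep {A T : Type u} [CStarAlgebra A] [CStarAlgebra T]
    (j : A ⊗[ℂ] A →⋆ₐ[ℂ] T) (Δ : A →⋆ₐ[ℂ] T) {N : ℕ} (v : Matrix (Fin N) (Fin N) A) : Prop where
  comul : ∀ i k, Δ (v i k) = ∑ l, j (v i l ⊗ₜ[ℂ] v l k)
  isUnit : IsUnit v
  isUnit_transpose : IsUnit v.transpose

/-- A compact quantum group, given by its Woronowicz C*-algebra: a unital C*-algebra `A = C(G)` with
a comultiplication `Δ` into the minimal tensor product `A ⊗ A` such that the coefficients of the
finite-dimensional representations generate a dense *-subalgebra. Coassociativity holds on these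
coefficients by `IsFiniteRep.comul`, hence on all of `A`. -/
structure CompactQuantumGroup where
  /-- The C*-algebra `C(G)`. -/
  A : Type u
  [cstarA : CStarAlgebra A]
  [nontrivialA : Nontrivial A]
  /-- The minimal tensor product `C(G) ⊗ C(G)`. -/
  T : Type u
  [cstarT : CStarAlgebra T]
  /-- The canonical map from the algebraic tensor product. -/
  j : A ⊗[ℂ] A →⋆ₐ[ℂ] T
  isMinimalTensor : IsMinimalTensor j
  /-- The comultiplication. -/
  Δ : A →⋆ₐ[ℂ] T
  dense : (StarAlgebra.adjoin ℂ {a : A | ∃ (N : ℕ) (v : Matrix (Fin N) (Fin N) A),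
    IsFiniteRep j Δ v ∧ ∃ i k, a = v i k}).topologicalClosure = ⊤

attribute [instance] CompactQuantumGroup.cstarA CompactQuantumGroup.nontrivialA
  CompactQuantumGroup.cstarT

/-- A unital *-homomorphism `f : C(G) → C(G')` is a morphism of Hopf C*-algebras:
`Δ' ∘ f = (f ⊗ f) ∘ Δ`. Here `F` is the map `f ⊗ f` of the minimal tensor products. -/
def IsHopfMorphism {G G' : CompactQuantumGroup.{u}} (f : G.A →⋆ₐ[ℂ] G'.A) : Prop :=
  ∃ F : G.T →⋆ₐ[ℂ] G'.T,
    (∀ a b, F (G.j (a ⊗ₜ[ℂ] b)) = G'.j (f a ⊗ₜ[ℂ] f b)) ∧ ∀ a, G'.Δ (f a) = F (G.Δ a)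

open Classical in
/-- A unitary representation of `G` on the Hilbert space `ℓ²(X)`: a unitary `U` of the Hilbert module
`ℓ²(X) ⊗ C(G)` (a unitary multiplier of `K(ℓ²(X)) ⊗ C(G)`), described by its matrix in the
standard basis, `U (δ_y ⊗ 1) = ∑ δ_x ⊗ U_xy`. All series converge in norm. -/
structure IsUnitaryRep (G : CompactQuantumGroup.{u}) {X : Type*} (U : X → X → G.A) : Prop where
  star_mul_self : ∀ x y, HasSum (fun z => star (U z x) * U z y) (if x = y then 1 else 0)
  mul_star_self : ∀ x y, HasSum (fun z => U x z * star (U y z)) (if x = y then 1 else 0)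
  comul : ∀ x y, HasSum (fun z => G.j (U x z ⊗ₜ[ℂ] U z y)) (G.Δ (U x y))

/-! ### The spectral triple of a group dual and its quantum isometry group -/

section GroupDual

variable {Γ : Type*} [Group Γ]

/-- The word length with respect to a generating set `S = S⁻¹`. -/
def wordLength (S : Set Γ) (g : Γ) : ℕ :=
  sInf {r | ∃ w : List Γ, w.length = r ∧ (∀ h ∈ w, h ∈ S) ∧ w.prod = g}

open Classical in
/-- The standard basis vector `δ_g` of `ℓ²(Γ)`. -/
def delta (g : Γ) : lp (fun _ : Γ => ℂ) 2 := lp.single 2 g (1 : ℂ)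

variable (Γ) in
/-- The image of `Γ` in `B(ℓ²(Γ))` under the left regular representation `g δ_h = δ_gh`. -/
def leftRegular : Set (lp (fun _ : Γ => ℂ) 2 →L[ℂ] lp (fun _ : Γ => ℂ) 2) :=
  {L | ∃ g : Γ, ∀ h, L (delta h) = delta (g * h)}

/-- The matrix coefficients `⟨δ_g ⊗ 1, α_U(γ) (δ_h ⊗ 1)⟩ ∈ C(G)` of the adjoint action
`α_U(γ) = U (γ ⊗ 1) U*` on a group element `γ`, acting on `ℓ²(Γ)` by left translation. -/
def adjointCoeff {G : CompactQuantumGroup.{u}} (U : Γ → Γ → G.A) (γ g h : Γ) : G.A :=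
  ∑' k, U g (γ * k) * star (U h k)

/-- `(G, U)` acts by orientation preserving isometries on the spectral triple
`(C*(Γ), ℓ²(Γ), D)`, `D δ_g = l(g) δ_g`, in the sense of Bhowmick and Goswami.
- `unitary`: `U` is a unitary representation of `G` on `ℓ²(Γ)`;
- `commutes`: `U` commutes with `D ⊗ 1`;
- `bicommutant`: `(id ⊗ φ) (α_U(γ))` belongs to the bicommutant of the algebra, for each bounded
  functional `φ` (linear combination of states) and each `γ` in `Γ` (by linearity, each element of
  the group algebra). -/
structure IsOrientationPreserving (S : Set Γ) (G : CompactQuantumGroup.{u}) (U : Γ → Γ → G.A) :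
    Prop where
  unitary : IsUnitaryRep G U
  commutes : ∀ g h, (wordLength S h : ℂ) • U g h = (wordLength S g : ℂ) • U g h
  bicommutant : ∀ (φ : G.A →L[ℂ] ℂ) (γ : Γ),
    ∃ L ∈ Set.centralizer (Set.centralizer (leftRegular Γ)),
      ∀ g h, inner ℂ (delta g) (L (delta h)) = φ (adjointCoeff U γ g h)

/-- `(G, U)` is universal among the compact quantum groups which act by orientation preserving
isometries. -/
structure IsUniversalOrientationPreserving (S : Set Γ) (G : CompactQuantumGroup.{u})
    (U : Γ → Γ → G.A) : Prop where
  isOrientationPreserving : IsOrientationPreserving S G U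
  universal : ∀ (G' : CompactQuantumGroup.{u}) (U' : Γ → Γ → G'.A),
    IsOrientationPreserving S G' U' →
      ∃! f : G.A →⋆ₐ[ℂ] G'.A, IsHopfMorphism f ∧ ∀ g h, f (U g h) = U' g h

/-- `G`, with its action `α(γ) = ∑ h ⊗ α(γ)_h` on the group algebra `ℂΓ` (where `ℂΓ ⊗ C(G)` is
identified with the finitely supported functions `Γ → C(G)`), is the quantum isometry group
`G⁺(Γ̂)` of Bhowmick and Goswami: `C(G)` is the Woronowicz C*-subalgebra, of the universal compact
quantum group `(Gt, U)` acting by orientation preserving isometries, which is generated by the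
coefficients of the adjoint action `α_U`, and `α` is the adjoint action. -/
def IsQuantumIsometryGroup (S : Set Γ) (G : CompactQuantumGroup.{u}) (α : Γ → (Γ →₀ G.A)) : Prop :=
  ∃ (Gt : CompactQuantumGroup.{u}) (U : Γ → Γ → Gt.A), IsUniversalOrientationPreserving S Gt U ∧
    ∃ f : G.A →⋆ₐ[ℂ] Gt.A, IsHopfMorphism f ∧ Function.Injective f ∧
      f.range = (StarAlgebra.adjoin ℂ
        {a : Gt.A | ∃ γ g h, a = adjointCoeff U γ g h}).topologicalClosure ∧
      ∀ γ g h, adjointCoeff U γ g h = f (α γ (g * h⁻¹))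

end GroupDual

/-! ### The hyperoctahedral quantum group -/

/-- A cubic matrix: an orthogonal matrix (self-adjoint entries, `v vᵗ = vᵗ v = 1`) such that on each
row and each column, the products of distinct entries vanish. -/
structure IsCubic {B : Type*} [CStarAlgebra B] {n : ℕ} (v : Matrix (Fin n) (Fin n) B) : Prop where
  selfAdjoint : ∀ i k, star (v i k) = v i k
  mul_transpose : v * v.transpose = 1
  transpose_mul : v.transpose * v = 1
  row : ∀ i k l, k ≠ l → v i k * v i l = 0
  col : ∀ i k l, k ≠ l → v k i * v l i = 0

/-- `G`, with the matrix `u` of generators, is the hyperoctahedral quantum group `H_n⁺`: `C(G)` is the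
universal unital C*-algebra generated by the entries of an `n × n` cubic matrix `u`, with the
comultiplication `Δ u_ik = ∑ u_il ⊗ u_lk`. -/
structure IsHyperoctahedral {n : ℕ} (G : CompactQuantumGroup.{u})
    (v : Matrix (Fin n) (Fin n) G.A) : Prop where
  isCubic : IsCubic v
  universal : ∀ (B : Type u) [CStarAlgebra B] (w : Matrix (Fin n) (Fin n) B), IsCubic w →
    ∃! f : G.A →⋆ₐ[ℂ] B, ∀ i k, f (v i k) = w i k
  comul : ∀ i k, G.Δ (v i k) = ∑ l, G.j (v i l ⊗ₜ[ℂ] v l k)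

/-! ### The group `ℤ₂ * ⋯ * ℤ₂` -/

/-- The free product of `n` copies of `ℤ₂`. -/
abbrev FreePowerZ2 (n : ℕ) : Type := Monoid.CoprodI (fun _ : Fin n => Multiplicative (ZMod 2))

/-- The standard generators of the free product of `n` copies of `ℤ₂`. They are involutions, so the
standard symmetric generating set is their range. -/
def gen {n : ℕ} (i : Fin n) : FreePowerZ2 n :=
  Monoid.CoprodI.of (M := fun _ : Fin n => Multiplicative (ZMod 2)) (i := i)
    (Multiplicative.ofAdd 1)

end

end QuantumIsometry

/-! Write Γ = ℤ₂ * ⋯ * ℤ₂. A unitary U that commutes with D ⊗ 1 is block diagonal along the spheres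
of Γ for the word length. These are finite, so every series that occurs is a finite sum, and the
block at 1 is a single group-like unitary a = `U 1 1`. By the bicommutant condition the matrix of
α(γ) = U(γ ⊗ 1)U* is invariant under right translations. Read in the column of 1, it shows that the
entry at (x, y) is U(xy⁻¹, γ)a* (`adjointCoeff_eq`). Hence α(g_i) = ∑ g_k ⊗ v_ki with v_ki = U(g_k,
g_i)a*. The v_ki are self-adjoint because g_i is an involution, v is orthogonal because U is
unitary, and for k ≠ l the coefficient of g_k g_l in α(g_i)² = 1 is v_ki v_li = 0. The row relations
follow, since the v_kl² for fixed k are projections with sum 1. So v is cubic (`isCubic_genMatrix`),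
and multiplicativity of α determines U from v and a (`eq_actionUnitary`).

Conversely, a cubic matrix v defines coefficients `coeff v x y`, the products of its entries along
reduced words. The cubic relations make them compatible with the cancellations g_i² = 1
(`IsCubic.coeff_gen_mul`), and unitarity, the adjoint and the comultiplication follow by induction
on words. If v is a representation and a is a group-like unitary, then `coeff v x y * a` acts by
orientation preserving isometries.

The universal such object is therefore the universal C*-algebra of a cubic matrix u and an unrelated
unitary a. The unitary a cancels in α, so the coefficients of α generate the subalgebra generated by
u; sending a to 1 shows that this subalgebra is C(H_n⁺). Any other universal pair has the same
lifting property by comparison with this model, which gives the converse.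

Existence is proved by completing the free *-algebra on self-adjoint generators in the supremum of
its C*-seminorms, which is finite because entries of cubic matrices are contractions. Minimal tensor
products are built the same way, and the comultiplication exists because ∑ v_il ⊗ v_lk is again
cubic. -/

namespace QuantumIsometry
noncomputable section

/-! ### C*-seminorms and their completions -/

/-- A C*-seminorm on a complex *-algebra. -/
structure CStarSeminorm (A : Type*) [Ring A] [StarRing A] [Algebra ℂ A] extends Seminorm ℂ A where
  mul_le : ∀ x y, toFun (x * y) ≤ toFun x * toFun y
  star_mul_self : ∀ x, toFun (star x * x) = toFun x * toFun x

namespace CStarSeminorm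

variable {A : Type*} [Ring A] [StarRing A] [Algebra ℂ A]

/-- The value of a C*-seminorm. -/
def val (p : CStarSeminorm A) (x : A) : ℝ := p.toSeminorm x

theorem val_nonneg (p : CStarSeminorm A) (x : A) : 0 ≤ p.val x := apply_nonneg p.toSeminorm x

theorem val_mul_le (p : CStarSeminorm A) (x y : A) : p.val (x * y) ≤ p.val x * p.val y :=
  p.mul_le x y

theorem val_star_mul_self (p : CStarSeminorm A) (x : A) :
    p.val (star x * x) = p.val x * p.val x := p.star_mul_self x

theorem val_add_le (p : CStarSeminorm A) (x y : A) : p.val (x + y) ≤ p.val x + p.val y :=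
  map_add_le_add p.toSeminorm x y

theorem val_smul (p : CStarSeminorm A) (c : ℂ) (x : A) : p.val (c • x) = ‖c‖ * p.val x :=
  map_smul_eq_mul p.toSeminorm c x

/-- The C*-identity and submultiplicativity give p(x)² ≤ p(x*) p(x). -/
theorem val_le_star (p : CStarSeminorm A) (x : A) : p.val x ≤ p.val (star x) := by
  by_contra! h
  have h1 := p.val_mul_le (star x) x
  rw [p.val_star_mul_self] at h1
  have h2 := p.val_nonneg (star x)
  nlinarith

theorem val_star (p : CStarSeminorm A) (x : A) : p.val (star x) = p.val x :=
  le_antisymm (by simpa using p.val_le_star (star x)) (p.val_le_star x)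

/-- The pointwise supremum of a nonempty, pointwise bounded set of C*-seminorms. -/
def sup (P : Set (CStarSeminorm A)) (hne : P.Nonempty)
    (hb : ∀ x, BddAbove ((fun q : CStarSeminorm A => q.val x) '' P)) : CStarSeminorm A where
  toFun x := sSup ((fun q : CStarSeminorm A => q.val x) '' P)
  map_zero' := by
    have : (fun q : CStarSeminorm A => q.val 0) '' P = {0} := by
      ext r
      constructor
      · rintro ⟨q, -, rfl⟩
        exact map_zero q.toSeminorm
      · rintro rfl
        obtain ⟨q, hq⟩ := hne
        exact ⟨q, hq, map_zero q.toSeminorm⟩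
    simp [this]
  add_le' x y := by
    refine csSup_le (hne.image _) ?_
    rintro _ ⟨q, hq, rfl⟩
    exact (q.val_add_le x y).trans
      (add_le_add (le_csSup (hb x) ⟨q, hq, rfl⟩) (le_csSup (hb y) ⟨q, hq, rfl⟩))
  neg' x := by
    congr 1
    refine Set.image_congr fun q _ => ?_
    exact map_neg_eq_map q.toSeminorm x
  smul' c x := by
    simp only [val_smul, sSup_image', Real.mul_iSup_of_nonneg (norm_nonneg c)]
  mul_le x y := by
    refine csSup_le (hne.image _) ?_
    rintro _ ⟨q, hq, rfl⟩
    exact (q.val_mul_le x y).trans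
      (mul_le_mul (le_csSup (hb x) ⟨q, hq, rfl⟩) (le_csSup (hb y) ⟨q, hq, rfl⟩) (q.val_nonneg y)
        ((q.val_nonneg x).trans (le_csSup (hb x) ⟨q, hq, rfl⟩)))
  star_mul_self x := by
    obtain ⟨q₀, hq₀⟩ := hne
    have h0 : 0 ≤ sSup ((fun q : CStarSeminorm A => q.val x) '' P) :=
      (q₀.val_nonneg x).trans (le_csSup (hb x) ⟨q₀, hq₀, rfl⟩)
    refine le_antisymm (csSup_le ⟨_, q₀, hq₀, rfl⟩ ?_) ?_
    · rintro _ ⟨q, hq, rfl⟩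
      have h1 : q.val x ≤ sSup ((fun q : CStarSeminorm A => q.val x) '' P) :=
        le_csSup (hb x) ⟨q, hq, rfl⟩
      simp only [q.val_star_mul_self]
      exact mul_le_mul h1 h1 (q.val_nonneg x) h0
    -- The remaining inequality is checked one seminorm at a time, as q(x) = √q(x*x).
    · have h1 : sSup ((fun q : CStarSeminorm A => q.val x) '' P)
          ≤ √(sSup ((fun q : CStarSeminorm A => q.val (star x * x)) '' P)) := by
        refine csSup_le ⟨_, q₀, hq₀, rfl⟩ ?_
        rintro _ ⟨q, hq, rfl⟩
        refine Real.le_sqrt_of_sq_le ?_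
        simp only [pow_two, ← q.val_star_mul_self]
        exact le_csSup (hb _) ⟨q, hq, rfl⟩
      have h2 : 0 ≤ sSup ((fun q : CStarSeminorm A => q.val (star x * x)) '' P) :=
        (q₀.val_nonneg _).trans (le_csSup (hb _) ⟨q₀, hq₀, rfl⟩)
      calc _ ≤ √(sSup ((fun q : CStarSeminorm A => q.val (star x * x)) '' P)) *
            √(sSup ((fun q : CStarSeminorm A => q.val (star x * x)) '' P)) :=
            mul_le_mul h1 h1 h0 (Real.sqrt_nonneg _)
        _ = _ := Real.mul_self_sqrt h2

theorem val_sup (P : Set (CStarSeminorm A)) (hne : P.Nonempty)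
    (hb : ∀ x, BddAbove ((fun q : CStarSeminorm A => q.val x) '' P)) (x : A) :
    (sup P hne hb).val x = sSup ((fun q : CStarSeminorm A => q.val x) '' P) := rfl

/-- The C*-seminorm pulled back from a C*-algebra. -/
def ofHom {B : Type*} [CStarAlgebra B] (φ : A →⋆ₐ[ℂ] B) : CStarSeminorm A where
  toFun x := ‖φ x‖
  map_zero' := by simp
  add_le' x y := by simpa using norm_add_le _ _
  neg' x := by simp
  smul' c x := by simp [norm_smul]
  mul_le x y := by simpa using norm_mul_le _ _
  star_mul_self x := by simp [map_star, CStarRing.norm_star_mul_self]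

theorem val_ofHom {B : Type*} [CStarAlgebra B] (φ : A →⋆ₐ[ℂ] B) (x : A) :
    (ofHom φ).val x = ‖φ x‖ := rfl

/-- A copy of the *-algebra `A`, carrying the topology of the seminorm `p`. -/
@[nolint unusedArguments]
def Copy (_p : CStarSeminorm A) : Type _ := A

variable (p : CStarSeminorm A)

instance : Ring p.Copy := inferInstanceAs (Ring A)
instance : StarRing p.Copy := inferInstanceAs (StarRing A)
instance : Algebra ℂ p.Copy := inferInstanceAs (Algebra ℂ A)

instance : SeminormedRing p.Copy where
  toRing := inferInstanceAs (Ring p.Copy)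
  __ := (show AddGroupSeminorm p.Copy from
    p.toSeminorm.toAddGroupSeminorm).toSeminormedAddCommGroup
  norm_mul_le := p.mul_le

instance : NormedAlgebra ℂ p.Copy where
  norm_smul_le c x := (p.val_smul c x).le

instance : NormedStarGroup p.Copy where
  norm_star_le x := (p.val_star x).le

/-- The C*-algebra obtained from a *-algebra by separation and completion in a C*-seminorm. -/
def Completion : Type _ := UniformSpace.Completion p.Copy

namespace Completion

open UniformSpace

instance : NormedRing p.Completion := inferInstanceAs (NormedRing (UniformSpace.Completion p.Copy))
instance : CompleteSpace p.Completion :=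
  inferInstanceAs (CompleteSpace (UniformSpace.Completion p.Copy))
instance : Algebra ℂ p.Completion := inferInstanceAs (Algebra ℂ (UniformSpace.Completion p.Copy))
instance : NormedAlgebra ℂ p.Completion where
  norm_smul_le c x := norm_smul_le (β := UniformSpace.Completion p.Copy) c x

/-- The canonical map into the completion. -/
def coe (x : A) : p.Completion := ((show p.Copy from x : p.Copy) : UniformSpace.Completion p.Copy)

theorem denseRange_coe : DenseRange (coe p) :=
  UniformSpace.Completion.denseRange_coe (α := p.Copy)

theorem norm_coe (x : A) : ‖coe p x‖ = p.val x :=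
  UniformSpace.Completion.norm_coe (show p.Copy from x)

theorem coe_add (x y : A) : coe p (x + y) = coe p x + coe p y :=
  UniformSpace.Completion.coe_add (show p.Copy from x) y

theorem coe_mul (x y : A) : coe p (x * y) = coe p x * coe p y :=
  UniformSpace.Completion.coe_mul (show p.Copy from x) y

theorem coe_smul (c : ℂ) (x : A) : coe p (c • x) = c • coe p x :=
  UniformSpace.Completion.coe_smul c (show p.Copy from x)

theorem coe_one : coe p 1 = 1 := UniformSpace.Completion.coe_one p.Copy

instance : Star p.Completion where
  star := UniformSpace.Completion.map (star : p.Copy → p.Copy)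

theorem continuous_star : Continuous (star : p.Completion → p.Completion) :=
  UniformSpace.Completion.continuous_map

theorem star_coe (x : A) : star (coe p x) = coe p (star x) :=
  UniformSpace.Completion.map_coe (star_isometry (E := p.Copy)).uniformContinuous _

variable [StarModule ℂ A]

instance : StarRing p.Completion where
  star_involutive x := by
    refine (denseRange_coe p).induction_on (p := fun x => star (star x) = x) x
      (isClosed_eq ?_ continuous_id) (fun x => ?_)
    · exact (continuous_star p).comp (continuous_star p)
    · simp [star_coe]
  star_mul x y := by
    refine (denseRange_coe p).induction_on₂ (p := fun x y => star (x * y) = star y * star x)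
      (isClosed_eq ?_ ?_) (fun x y => ?_) x y
    · exact (continuous_star p).comp continuous_mul
    · exact ((continuous_star p).comp continuous_snd).mul ((continuous_star p).comp continuous_fst)
    · simp [star_coe, ← coe_mul]
  star_add x y := by
    refine (denseRange_coe p).induction_on₂ (p := fun x y => star (x + y) = star x + star y)
      (isClosed_eq ?_ ?_) (fun x y => ?_) x y
    · exact (continuous_star p).comp continuous_add
    · exact ((continuous_star p).comp continuous_fst).add ((continuous_star p).comp continuous_snd)
    · simp [star_coe, ← coe_add]

instance : CStarAlgebra p.Completion where
  norm_mul_self_le x := by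
    refine (denseRange_coe p).induction_on (p := fun x => ‖x‖ * ‖x‖ ≤ ‖star x * x‖) x
      (isClosed_le ?_ ?_) (fun x => ?_)
    · fun_prop
    · exact continuous_norm.comp ((continuous_star p).mul continuous_id)
    · simp only [star_coe, ← coe_mul, norm_coe, val_star_mul_self, le_refl]
  star_smul c x := by
    refine (denseRange_coe p).induction_on (p := fun x => star (c • x) = star c • star x) x
      (isClosed_eq ?_ ?_) (fun x => ?_)
    · exact (continuous_star p).comp (continuous_const_smul c)
    · exact (continuous_star p).const_smul (star c)
    · simp [star_coe, ← coe_smul]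

/-- The canonical *-homomorphism into the completion. -/
def of : A →⋆ₐ[ℂ] p.Completion where
  toFun := coe p
  map_one' := coe_one p
  map_mul' := coe_mul p
  map_zero' := by simpa using coe_smul p 0 0
  map_add' := coe_add p
  commutes' c := by
    rw [Algebra.algebraMap_eq_smul_one, Algebra.algebraMap_eq_smul_one, coe_smul, coe_one]
  map_star' x := (star_coe p x).symm

theorem denseRange_of : DenseRange (of p) := denseRange_coe p

theorem norm_of (x : A) : ‖of p x‖ = p.val x := norm_coe p x

end Completion
end CStarSeminorm

/-! ### Extension of *-homomorphisms -/

section Extension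

variable {A B T : Type*} [Ring A] [StarRing A] [Algebra ℂ A] [CStarAlgebra B] [CStarAlgebra T]

/-- A *-homomorphism which is dominated by a *-homomorphism with dense range factors through it. -/
theorem exists_extension {j : A →⋆ₐ[ℂ] T} (hj : DenseRange j) (φ : A →⋆ₐ[ℂ] B)
    (h : ∀ x, ‖φ x‖ ≤ ‖j x‖) :
    ∃ Φ : T →⋆ₐ[ℂ] B, ∀ x, Φ (j x) = φ x := by
  let φl : A →ₗ[ℂ] B := φ.toAlgHom.toLinearMap
  let jl : A →ₗ[ℂ] T := j.toAlgHom.toLinearMap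
  let F : T →L[ℂ] B := φl.extendOfNorm jl
  have hF : ∀ x, F (j x) = φ x :=
    LinearMap.extendOfNorm_eq (f := φl) (e := jl) hj ⟨1, fun x => (h x).trans_eq (one_mul _).symm⟩
  refine ⟨{
    toFun := F
    map_one' := ?_
    map_mul' := ?_
    map_zero' := map_zero F
    map_add' := map_add F
    commutes' := ?_
    map_star' := ?_ }, hF⟩
  · simpa using hF 1
  · intro x y
    refine hj.induction_on₂ (p := fun x y => F (x * y) = F x * F y)
      (isClosed_eq (by fun_prop) (by fun_prop)) (fun x y => ?_) x y
    rw [← map_mul, hF, hF, hF, map_mul]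
  · intro c
    have : F (1 : T) = 1 := by simpa using hF 1
    simp [Algebra.algebraMap_eq_smul_one, this]
  · intro x
    refine hj.induction_on (p := fun x => F (star x) = star (F x)) x
      (isClosed_eq (by fun_prop) (by fun_prop)) (fun x => ?_)
    rw [← map_star, hF, hF, map_star]

theorem continuous_starAlgHom (f : T →⋆ₐ[ℂ] B) : Continuous f :=
  AddMonoidHomClass.continuous_of_bound f 1 fun x => by
    simpa using NonUnitalStarAlgHom.norm_apply_le f x

theorem starAlgHom_ext_of_denseRange {j : A →⋆ₐ[ℂ] T} (hj : DenseRange j) {f g : T →⋆ₐ[ℂ] B}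
    (h : ∀ x, f (j x) = g (j x)) : f = g :=
  StarAlgHom.ext fun x => congrFun
    (hj.equalizer (continuous_starAlgHom f) (continuous_starAlgHom g) (funext h)) x

end Extension

end
end QuantumIsometry

namespace QuantumIsometry
noncomputable section

/-! ### Existence and functoriality of the minimal tensor product -/

section TensorRep

/-- The algebraic tensor product of Hilbert spaces is not complete, so only formal adjoints are at
hand. They suffice: ‖Pξ‖² = ⟨ξ, QPξ⟩ ≤ ‖QP‖ ‖ξ‖². -/
theorem norm_mul_self_le_of_inner_eq {E : Type*} [NormedAddCommGroup E] [InnerProductSpace ℂ E]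
    {P Q : E →L[ℂ] E} (h : ∀ ξ η, inner ℂ (P ξ) η = inner ℂ ξ (Q η)) :
    ‖P‖ * ‖P‖ ≤ ‖Q * P‖ := by
  have h1 : ‖P‖ ≤ √‖Q * P‖ := by
    refine ContinuousLinearMap.opNorm_le_bound _ (Real.sqrt_nonneg _) fun ξ => ?_
    refine (abs_le_of_sq_le_sq' ?_ (mul_nonneg (Real.sqrt_nonneg _) (norm_nonneg _))).2
    rw [mul_pow, Real.sq_sqrt (norm_nonneg _), pow_two, ← inner_self_eq_norm_mul_norm (𝕜 := ℂ), h]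
    calc _ ≤ ‖inner ℂ ξ ((Q * P) ξ)‖ := RCLike.re_le_norm _
      _ ≤ ‖ξ‖ * ‖(Q * P) ξ‖ := norm_inner_le_norm _ _
      _ ≤ ‖ξ‖ * (‖Q * P‖ * ‖ξ‖) := by gcongr; exact ContinuousLinearMap.le_opNorm _ _
      _ = _ := by ring
  calc _ ≤ √‖Q * P‖ * √‖Q * P‖ := by gcongr
    _ = _ := Real.mul_self_sqrt (norm_nonneg _)

variable {A B H K : Type*} [CStarAlgebra A] [CStarAlgebra B]
  [NormedAddCommGroup H] [InnerProductSpace ℂ H] [CompleteSpace H]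
  [NormedAddCommGroup K] [InnerProductSpace ℂ K] [CompleteSpace K]
  (π : A →⋆ₐ[ℂ] (H →L[ℂ] H)) (ρ : B →⋆ₐ[ℂ] (K →L[ℂ] K))

@[simp]
theorem tensorRep_tmul (a : A) (b : B) :
    tensorRep π ρ (a ⊗ₜ[ℂ] b) = TensorProduct.mapL (π a) (ρ b) := rfl

theorem tensorRep_mul (x y : A ⊗[ℂ] B) :
    tensorRep π ρ (x * y) = tensorRep π ρ x * tensorRep π ρ y := by
  induction x with
  | zero => simp
  | add x₁ x₂ h₁ h₂ => rw [add_mul, map_add, map_add, h₁, h₂, add_mul]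
  | tmul a b =>
    induction y with
    | zero => simp
    | add y₁ y₂ h₁ h₂ => rw [mul_add, map_add, map_add, h₁, h₂, mul_add]
    | tmul a' b' => simp [TensorProduct.mapL_mul]

theorem inner_tensorRep_left (x : A ⊗[ℂ] B) (ξ η : H ⊗[ℂ] K) :
    inner ℂ (tensorRep π ρ x ξ) η = inner ℂ ξ (tensorRep π ρ (star x) η) := by
  induction x with
  | zero => simp
  | add x₁ x₂ h₁ h₂ => simp [inner_add_left, inner_add_right, h₁, h₂]
  | tmul a b =>
    induction ξ with
    | zero => simp
    | add ξ₁ ξ₂ h₁ h₂ => rw [map_add, inner_add_left, inner_add_left, h₁, h₂]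
    | tmul h k =>
      induction η with
      | zero => simp
      | add η₁ η₂ h₁ h₂ => rw [map_add, inner_add_right, inner_add_right, h₁, h₂]
      | tmul h' k' =>
        simp [map_star, ContinuousLinearMap.star_eq_adjoint,
          ContinuousLinearMap.adjoint_inner_right]

theorem norm_mul_self_tensorRep_le (x : A ⊗[ℂ] B) :
    ‖tensorRep π ρ x‖ * ‖tensorRep π ρ x‖ ≤ ‖tensorRep π ρ (star x * x)‖ := by
  rw [tensorRep_mul]
  exact norm_mul_self_le_of_inner_eq fun ξ η => inner_tensorRep_left π ρ x ξ η

theorem norm_tensorRep_mul_le (x y : A ⊗[ℂ] B) :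
    ‖tensorRep π ρ (x * y)‖ ≤ ‖tensorRep π ρ x‖ * ‖tensorRep π ρ y‖ := by
  rw [tensorRep_mul]
  exact ContinuousLinearMap.opNorm_comp_le _ _

theorem norm_tensorRep_le_star (x : A ⊗[ℂ] B) :
    ‖tensorRep π ρ x‖ ≤ ‖tensorRep π ρ (star x)‖ := by
  by_contra! h
  have h1 := (norm_mul_self_tensorRep_le π ρ x).trans (norm_tensorRep_mul_le π ρ _ _)
  have h2 : 0 ≤ ‖tensorRep π ρ (star x)‖ := ContinuousLinearMap.opNorm_nonneg _
  nlinarith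

theorem norm_tensorRep_star_mul_self (x : A ⊗[ℂ] B) :
    ‖tensorRep π ρ (star x * x)‖ = ‖tensorRep π ρ x‖ * ‖tensorRep π ρ x‖ := by
  refine le_antisymm ((norm_tensorRep_mul_le π ρ _ _).trans ?_) (norm_mul_self_tensorRep_le π ρ x)
  have h := norm_tensorRep_le_star π ρ (star x)
  rw [star_star] at h
  exact mul_le_mul_of_nonneg_right h (ContinuousLinearMap.opNorm_nonneg _)

/-- The C*-seminorm defined by a tensor product of representations. -/
def tensorSeminorm : CStarSeminorm (A ⊗[ℂ] B) where
  toSeminorm := Seminorm.ofSMulLE (fun x => ‖tensorRep π ρ x‖)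
    (by rw [map_zero]; exact ContinuousLinearMap.opNorm_zero)
    (fun x y => by rw [map_add]; exact ContinuousLinearMap.opNorm_add_le _ _)
    (fun c x => by rw [map_smul]; exact ContinuousLinearMap.opNorm_smul_le c _)
  mul_le := norm_tensorRep_mul_le π ρ
  star_mul_self := norm_tensorRep_star_mul_self π ρ

end TensorRep

/-! ### The minimal C*-norm and its functoriality -/

section Minimal

variable {A B T A' B' T' : Type u} [CStarAlgebra A] [CStarAlgebra B] [CStarAlgebra T]
  [CStarAlgebra A'] [CStarAlgebra B'] [CStarAlgebra T']

/-- Representations are contractive, so a ⊗ b is bounded by ‖a‖ ‖b‖ uniformly in the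
representations; sums add the bounds. -/
theorem bddAbove_minimalNormValues (x : A ⊗[ℂ] B) : BddAbove (minimalNormValues x) := by
  have : ∃ C : ℝ, ∀ (H K : Type u)
      (_ : NormedAddCommGroup H) (_ : InnerProductSpace ℂ H) (_ : CompleteSpace H)
      (_ : NormedAddCommGroup K) (_ : InnerProductSpace ℂ K) (_ : CompleteSpace K)
      (π : A →⋆ₐ[ℂ] (H →L[ℂ] H)) (ρ : B →⋆ₐ[ℂ] (K →L[ℂ] K)), ‖tensorRep π ρ x‖ ≤ C := by
    induction x with
    | zero => exact ⟨0, fun H K _ _ _ _ _ _ π ρ => by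
        rw [map_zero]; exact ContinuousLinearMap.opNorm_zero.le⟩
    | add x y hx hy =>
      obtain ⟨C, hC⟩ := hx
      obtain ⟨D, hD⟩ := hy
      refine ⟨C + D, fun H K _ _ _ _ _ _ π ρ => ?_⟩
      rw [map_add]
      exact (ContinuousLinearMap.opNorm_add_le _ _).trans
        (add_le_add (hC H K _ _ ‹_› _ _ ‹_› π ρ) (hD H K _ _ ‹_› _ _ ‹_› π ρ))
    | tmul a b =>
      refine ⟨‖a‖ * ‖b‖, fun H K _ _ _ _ _ _ π ρ => ?_⟩
      refine (TensorProduct.norm_mapL_le _ _).trans ?_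
      exact mul_le_mul (NonUnitalStarAlgHom.norm_apply_le π a)
        (NonUnitalStarAlgHom.norm_apply_le ρ b) (norm_nonneg _) (norm_nonneg _)
  obtain ⟨C, hC⟩ := this
  refine ⟨C, ?_⟩
  rintro _ ⟨H, K, _, _, _, _, _, _, π, ρ, rfl⟩
  exact hC H K _ _ ‹_› _ _ ‹_› π ρ

variable (A B) in
/-- The C*-seminorms on `A ⊗ B` defined by tensor products of representations. -/
def tensorSeminorms : Set (CStarSeminorm (A ⊗[ℂ] B)) :=
  {q | ∃ (H K : Type u)
      (_ : NormedAddCommGroup H) (_ : InnerProductSpace ℂ H) (_ : CompleteSpace H)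
      (_ : NormedAddCommGroup K) (_ : InnerProductSpace ℂ K) (_ : CompleteSpace K)
      (π : A →⋆ₐ[ℂ] (H →L[ℂ] H)) (ρ : B →⋆ₐ[ℂ] (K →L[ℂ] K)), q = tensorSeminorm π ρ}

theorem image_tensorSeminorms (x : A ⊗[ℂ] B) :
    (fun q : CStarSeminorm (A ⊗[ℂ] B) => q.val x) '' tensorSeminorms A B
      = minimalNormValues x := by
  ext r
  constructor
  · rintro ⟨_, ⟨H, K, _, _, _, _, _, _, π, ρ, rfl⟩, rfl⟩
    exact ⟨H, K, _, _, ‹_›, _, _, ‹_›, π, ρ, rfl⟩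
  · rintro ⟨H, K, _, _, _, _, _, _, π, ρ, rfl⟩
    exact ⟨_, ⟨H, K, _, _, ‹_›, _, _, ‹_›, π, ρ, rfl⟩, rfl⟩

/-- The trivial representation on the zero space. -/
def zeroRep (A : Type*) [CStarAlgebra A] :
    A →⋆ₐ[ℂ] (PUnit.{u + 1} →L[ℂ] PUnit.{u + 1}) where
  toFun _ := 0
  map_one' := Subsingleton.elim _ _
  map_mul' _ _ := Subsingleton.elim _ _
  map_zero' := rfl
  map_add' _ _ := Subsingleton.elim _ _
  commutes' _ := Subsingleton.elim _ _
  map_star' _ := Subsingleton.elim _ _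

/-- On the zero space 0 = 1, so the zero map is a unital representation; no faithful representation
is needed. -/
theorem tensorSeminorms_nonempty : (tensorSeminorms A B).Nonempty :=
  ⟨_, _, _, _, _, _, _, _, _, zeroRep A, zeroRep B, rfl⟩

variable (A B) in
/-- The minimal C*-norm on `A ⊗ B`. -/
def minimalSeminorm : CStarSeminorm (A ⊗[ℂ] B) :=
  .sup (tensorSeminorms A B) tensorSeminorms_nonempty fun x => by
    rw [image_tensorSeminorms]
    exact bddAbove_minimalNormValues x

theorem isMinimalTensor_completion :
    IsMinimalTensor (CStarSeminorm.Completion.of (minimalSeminorm A B)) where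
  dense := CStarSeminorm.Completion.denseRange_of _
  norm x := by
    rw [CStarSeminorm.Completion.norm_of, minimalSeminorm, CStarSeminorm.val_sup,
      image_tensorSeminorms]
    refine isLUB_csSup ?_ (bddAbove_minimalNormValues x)
    rw [← image_tensorSeminorms]
    exact tensorSeminorms_nonempty.image _

/-- The tensor product of two *-homomorphisms. -/
def starTensorMap (f : A →⋆ₐ[ℂ] A') (g : B →⋆ₐ[ℂ] B') : A ⊗[ℂ] B →⋆ₐ[ℂ] A' ⊗[ℂ] B' where
  __ := Algebra.TensorProduct.map f.toAlgHom g.toAlgHom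
  map_star' x := by
    induction x with
    | zero => simp
    | add x y hx hy => simp_all
    | tmul a b => simp [map_star]

@[simp]
theorem starTensorMap_tmul (f : A →⋆ₐ[ℂ] A') (g : B →⋆ₐ[ℂ] B') (a : A) (b : B) :
    starTensorMap f g (a ⊗ₜ b) = f a ⊗ₜ g b := rfl

/-- Representations of A' and B' pull back along f and g, so f ⊗ g does not increase the minimal
norm and extends to the completions. -/
theorem IsMinimalTensor.exists_map {j : A ⊗[ℂ] B →⋆ₐ[ℂ] T} (hj : IsMinimalTensor j)
    {j' : A' ⊗[ℂ] B' →⋆ₐ[ℂ] T'} (hj' : IsMinimalTensor j')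
    (f : A →⋆ₐ[ℂ] A') (g : B →⋆ₐ[ℂ] B') :
    ∃ F : T →⋆ₐ[ℂ] T', ∀ a b, F (j (a ⊗ₜ[ℂ] b)) = j' (f a ⊗ₜ[ℂ] g b) := by
  obtain ⟨F, hF⟩ := exists_extension hj.dense (j'.comp (starTensorMap f g)) fun x => by
    refine (isLUB_le_iff (hj'.norm _)).2 ?_
    rintro _ ⟨H, K, _, _, _, _, _, _, π, ρ, rfl⟩
    refine (hj.norm x).1 ⟨H, K, _, _, ‹_›, _, _, ‹_›, π.comp f, ρ.comp g, ?_⟩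
    congr 1
    induction x with
    | zero => simp
    | add x y hx hy => simp_all
    | tmul a b => simp
  exact ⟨F, fun a b => hF _⟩

theorem IsMinimalTensor.hom_ext {j : A ⊗[ℂ] B →⋆ₐ[ℂ] T} (hj : IsMinimalTensor j)
    {F F' : T →⋆ₐ[ℂ] T'} (h : ∀ a b, F (j (a ⊗ₜ[ℂ] b)) = F' (j (a ⊗ₜ[ℂ] b))) : F = F' := by
  refine starAlgHom_ext_of_denseRange hj.dense fun x => ?_
  induction x with
  | zero => simp
  | add x y hx hy => simp_all
  | tmul a b => exact h a b

end Minimal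
end
end QuantumIsometry

namespace QuantumIsometry
noncomputable section

/-! ### Universal C*-algebras on self-adjoint contractions -/

section Universal

/-- The star of a free algebra fixes the scalars as well as the generators, so it is conjugate
linear over ℝ but not over ℂ. The complex conjugation comes from tensoring with ℂ afterwards. -/
instance {X : Type*} : StarModule ℝ (FreeAlgebra ℝ X) where
  star_smul r x := by
    simp [Algebra.smul_def, FreeAlgebra.star_algebraMap, Algebra.commutes]

/-- The free complex *-algebra on self-adjoint generators. -/
abbrev FreeStarAlgebra (X : Type u) : Type u := ℂ ⊗[ℝ] FreeAlgebra ℝ X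

namespace FreeStarAlgebra

variable {X : Type u} {B : Type*} [Ring B] [StarRing B] [Algebra ℂ B] [StarModule ℂ B]

instance : StarModule ℂ (FreeStarAlgebra X) where
  star_smul c x := by
    induction x using TensorProduct.induction_on with
    | zero => simp
    | add x y hx hy => simp_all
    | tmul a b => simp [TensorProduct.smul_tmul']

/-- The generators. -/
def var (x : X) : FreeStarAlgebra X := 1 ⊗ₜ FreeAlgebra.ι ℝ x

/-- Evaluation at a family of self-adjoint elements. -/
def eval (w : X → B) (hw : ∀ x, star (w x) = w x) : FreeStarAlgebra X →⋆ₐ[ℂ] B :=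
  let _ : Algebra ℝ B := Algebra.compHom B (algebraMap ℝ ℂ)
  have : IsScalarTower ℝ ℂ B := IsScalarTower.of_algebraMap_eq fun _ => rfl
  { AlgHom.liftEquiv ℝ ℂ (FreeAlgebra ℝ X) B (FreeAlgebra.lift ℝ w) with
    map_star' := fun x => by
      have key : ∀ y : FreeAlgebra ℝ X,
          FreeAlgebra.lift ℝ w (star y) = star (FreeAlgebra.lift ℝ w y) := by
        intro y
        induction y with
        | grade0 r =>
          rw [FreeAlgebra.star_algebraMap, AlgHom.commutes, IsScalarTower.algebraMap_apply ℝ ℂ B,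
            ← algebraMap_star_comm]
          simp
        | grade1 x => simp [hw]
        | mul a b ha hb => simp [ha, hb]
        | add a b ha hb => simp [ha, hb]
      induction x using TensorProduct.induction_on with
      | zero => simp
      | add x y hx hy => simp_all
      | tmul a b => simp [key] }

@[simp]
theorem eval_var (w : X → B) (hw : ∀ x, star (w x) = w x) (x : X) :
    eval w hw (var x) = w x := by
  change (1 : ℂ) • FreeAlgebra.lift (A := B) ℝ w (FreeAlgebra.ι ℝ x) = w x
  simp

theorem induction {P : FreeStarAlgebra X → Prop} (var : ∀ x, P (var x)) (one : P 1)
    (smul : ∀ (c : ℂ) x, P x → P (c • x)) (add : ∀ x y, P x → P y → P (x + y))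
    (mul : ∀ x y, P x → P y → P (x * y)) (x : FreeStarAlgebra X) : P x := by
  have key : ∀ y : FreeAlgebra ℝ X, P (1 ⊗ₜ y) := by
    intro y
    induction y with
    | grade0 r =>
      have : (1 : ℂ) ⊗ₜ[ℝ] algebraMap ℝ (FreeAlgebra ℝ X) r = (r : ℂ) • (1 : FreeStarAlgebra X) := by
        rw [Algebra.algebraMap_eq_smul_one, TensorProduct.tmul_smul,
          Algebra.TensorProduct.one_def]
        simp [TensorProduct.smul_tmul']
      rw [this]
      exact smul _ _ one
    | grade1 x => exact var x
    | mul a b ha hb =>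
      have := mul _ _ ha hb
      rwa [Algebra.TensorProduct.tmul_mul_tmul, one_mul] at this
    | add a b ha hb =>
      rw [TensorProduct.tmul_add]
      exact add _ _ ha hb
  induction x using TensorProduct.induction_on with
  | zero => simpa using smul 0 _ one
  | add x y hx hy => exact add _ _ hx hy
  | tmul a b => simpa [TensorProduct.smul_tmul'] using smul a _ (key b)

end FreeStarAlgebra

variable {X : Type u}

/-- A family of self-adjoint contractions which satisfies a given relation. -/
structure IsAdmissible (R : ∀ (B : Type u) [CStarAlgebra B], (X → B) → Prop) {B : Type u}
    [CStarAlgebra B] (w : X → B) : Prop where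
  selfAdjoint : ∀ x, star (w x) = w x
  norm_le : ∀ x, ‖w x‖ ≤ 1
  rel : R B w

-- The relation R is arbitrary, so the universal family need not satisfy it. The last clause
-- replaces this: *-polynomial identities valid for all admissible families pass to the universal
-- one.
open FreeStarAlgebra in
theorem exists_universal (R : ∀ (B : Type u) [CStarAlgebra B], (X → B) → Prop)
    (hne : ∃ (B : Type u) (_ : CStarAlgebra B) (w : X → B), IsAdmissible R w) :
    ∃ (U : Type u) (_ : CStarAlgebra U) (g : X → U) (hg : ∀ x, star (g x) = g x),
      (∀ (B : Type u) [CStarAlgebra B] (w : X → B), IsAdmissible R w →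
        ∃ f : U →⋆ₐ[ℂ] B, ∀ x, f (g x) = w x) ∧
      (∀ (B : Type u) [CStarAlgebra B] (f f' : U →⋆ₐ[ℂ] B), (∀ x, f (g x) = f' (g x)) → f = f') ∧
      ∀ a b : FreeStarAlgebra X, (∀ (B : Type u) [CStarAlgebra B] (w : X → B)
        (hw : IsAdmissible R w), eval w hw.selfAdjoint a = eval w hw.selfAdjoint b) →
        eval g hg a = eval g hg b := by
  -- Quantifying over seminorms on one fixed algebra, rather than over the target algebras, keeps
  -- the supremum within a set.
  let P : Set (CStarSeminorm (FreeStarAlgebra X)) :=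
    {q | ∃ (B : Type u) (_ : CStarAlgebra B) (w : X → B) (hw : IsAdmissible R w),
      q = CStarSeminorm.ofHom (eval w hw.selfAdjoint)}
  have hP : P.Nonempty := by
    obtain ⟨B, _, w, hw⟩ := hne
    exact ⟨_, B, _, w, hw, rfl⟩
  have hb : ∀ x, BddAbove ((fun q : CStarSeminorm (FreeStarAlgebra X) => q.val x) '' P) := by
    intro x
    have : ∃ C : ℝ, ∀ (B : Type u) (_ : CStarAlgebra B) (w : X → B) (hw : IsAdmissible R w),
        ‖eval w hw.selfAdjoint x‖ ≤ C := by
      refine FreeStarAlgebra.induction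
        (P := fun x => ∃ C : ℝ, ∀ (B : Type u) (_ : CStarAlgebra B) (w : X → B)
          (hw : IsAdmissible R w), ‖eval w hw.selfAdjoint x‖ ≤ C) ?_ ?_ ?_ ?_ ?_ x
      · exact fun x => ⟨1, fun B _ w hw => by simpa using hw.norm_le x⟩
      · refine ⟨1, fun B _ w hw => ?_⟩
        rcases subsingleton_or_nontrivial B with h | h
        · rw [Subsingleton.elim (eval w hw.selfAdjoint 1) 0]
          simp
        · simp
      · rintro c x ⟨C, hC⟩
        refine ⟨‖c‖ * C, fun B _ w hw => ?_⟩
        rw [map_smul, norm_smul]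
        exact mul_le_mul_of_nonneg_left (hC B _ w hw) (norm_nonneg _)
      · rintro x y ⟨C, hC⟩ ⟨D, hD⟩
        refine ⟨C + D, fun B _ w hw => ?_⟩
        rw [map_add]
        exact (norm_add_le _ _).trans (add_le_add (hC B _ w hw) (hD B _ w hw))
      · rintro x y ⟨C, hC⟩ ⟨D, hD⟩
        refine ⟨C * D, fun B _ w hw => ?_⟩
        rw [map_mul]
        exact (norm_mul_le _ _).trans (mul_le_mul (hC B _ w hw) (hD B _ w hw) (norm_nonneg _)
          ((norm_nonneg _).trans (hC B _ w hw)))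
    obtain ⟨C, hC⟩ := this
    refine ⟨C, ?_⟩
    rintro _ ⟨_, ⟨B, _, w, hw, rfl⟩, rfl⟩
    exact hC B _ w hw
  let p := CStarSeminorm.sup P hP hb
  let ι := CStarSeminorm.Completion.of p
  have hι : DenseRange ι := CStarSeminorm.Completion.denseRange_of p
  have hvar : ∀ x : X, star (var x) = var x := fun x => by simp [var]
  have hg : ∀ x : X, star (ι (var x)) = ι (var x) := fun x => by rw [← map_star, hvar]
  have hom_ext : ∀ {B : Type u} [CStarAlgebra B] (f f' : FreeStarAlgebra X →⋆ₐ[ℂ] B),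
      (∀ x, f (var x) = f' (var x)) → f = f' := by
    intro B _ f f' h
    refine StarAlgHom.ext fun x => ?_
    refine FreeStarAlgebra.induction (P := fun x => f x = f' x) h ?_ ?_ ?_ ?_ x
    · simp
    · intro c x hx
      simp [hx]
    · intro x y hx hy
      simp [hx, hy]
    · intro x y hx hy
      simp [hx, hy]
  have hevalι : eval (fun x => ι (var x)) hg = ι := hom_ext _ _ fun x => by simp
  refine ⟨p.Completion, inferInstance, fun x => ι (var x), hg, ?_, ?_, ?_⟩
  · intro B _ w hw
    obtain ⟨f, hf⟩ := exists_extension hι (eval w hw.selfAdjoint) fun x => by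
      rw [CStarSeminorm.Completion.norm_of]
      exact le_csSup (hb x) ⟨_, ⟨B, _, w, hw, rfl⟩, rfl⟩
    exact ⟨f, fun x => by rw [hf, eval_var]⟩
  · intro B _ f f' h
    refine starAlgHom_ext_of_denseRange hι fun x => ?_
    exact DFunLike.congr_fun (hom_ext (f.comp ι) (f'.comp ι) h) x
  · intro a b h
    rw [hevalι, ← sub_eq_zero, ← map_sub, ← norm_eq_zero, CStarSeminorm.Completion.norm_of]
    refine le_antisymm (csSup_le (hP.image _) ?_) (p.val_nonneg _)
    rintro _ ⟨_, ⟨B, _, w, hw, rfl⟩, rfl⟩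
    simp only [CStarSeminorm.val_ofHom]
    rw [map_sub, h B w hw, sub_self, norm_zero]

end Universal
end
end QuantumIsometry

namespace QuantumIsometry
noncomputable section

/-! ### Cubic matrices -/

section Cubic

theorem norm_le_one_of_star_mul_self {B : Type*} [CStarAlgebra B] {p : B}
    (hp : star p * p = p) : ‖p‖ ≤ 1 := by
  have h := CStarRing.norm_star_mul_self (x := p)
  rw [hp] at h
  by_contra! h1
  nlinarith

theorem norm_le_one_of_mem_unitary {B : Type*} [CStarAlgebra B] {a : B}
    (ha : a ∈ unitary B) : ‖a‖ ≤ 1 := by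
  have h := CStarRing.norm_star_mul_self (x := a)
  rw [Unitary.star_mul_self_of_mem ha] at h
  have h1 : ‖(1 : B)‖ ≤ 1 := norm_le_one_of_star_mul_self (by simp)
  by_contra! h2
  nlinarith

/-- Projections which sum to `1` are mutually orthogonal. -/
theorem mul_eq_zero_of_sum_projections {B ι : Type*} [CStarAlgebra B] [Fintype ι] {p : ι → B}
    (hp : ∀ i, star (p i) = p i) (hp' : ∀ i, p i * p i = p i) (hsum : ∑ i, p i = 1)
    {i j : ι} (hij : i ≠ j) : p i * p j = 0 := by
  classical
  let _ : PartialOrder B := CStarAlgebra.spectralOrder B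
  have : StarOrderedRing B := CStarAlgebra.spectralOrderedRing B
  -- Compress ∑ p_k = 1 by p_j: the terms p_j p_k p_j with k ≠ j are positive and sum to 0, so each
  -- of them vanishes.
  have h1 : ∑ k ∈ Finset.univ.erase j, star (p k * p j) * (p k * p j) = 0 := by
    have h2 : ∀ k, star (p k * p j) * (p k * p j) = p j * p k * p j := fun k => by
      rw [star_mul, hp, hp, mul_assoc, ← mul_assoc (p k), hp', mul_assoc]
    have h3 : ∑ k, p j * p k * p j = p j := by
      rw [← Finset.sum_mul, ← Finset.mul_sum, hsum, mul_one, hp']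
    rw [← Finset.add_sum_erase _ _ (Finset.mem_univ j), hp', hp'] at h3
    rw [Finset.sum_congr rfl fun k _ => h2 k]
    exact left_eq_add.1 h3.symm
  have h4 := (Finset.sum_eq_zero_iff_of_nonneg fun k _ => star_mul_self_nonneg (p k * p j)).1 h1 i
    (by simp [hij])
  exact CStarRing.star_mul_self_eq_zero_iff _ |>.1 h4

variable {B B' : Type*} [CStarAlgebra B] [CStarAlgebra B'] {n : ℕ}
  {v : Matrix (Fin n) (Fin n) B}

theorem isCubic_iff_sum : IsCubic v ↔ (∀ i k, star (v i k) = v i k) ∧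
    (∀ i k, ∑ l, v i l * v k l = if i = k then 1 else 0) ∧
    (∀ i k, ∑ l, v l i * v l k = if i = k then 1 else 0) ∧
    (∀ i k l, k ≠ l → v i k * v i l = 0) ∧ ∀ i k l, k ≠ l → v k i * v l i = 0 := by
  constructor
  · rintro ⟨h1, h2, h3, h4, h5⟩
    refine ⟨h1, fun i k => ?_, fun i k => ?_, h4, h5⟩
    · simpa [Matrix.mul_apply, Matrix.one_apply] using congrFun (congrFun h2 i) k
    · simpa [Matrix.mul_apply, Matrix.one_apply] using congrFun (congrFun h3 i) k
  · rintro ⟨h1, h2, h3, h4, h5⟩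
    refine ⟨h1, ?_, ?_, h4, h5⟩
    · ext i k
      simpa [Matrix.mul_apply, Matrix.one_apply] using h2 i k
    · ext i k
      simpa [Matrix.mul_apply, Matrix.one_apply] using h3 i k

namespace IsCubic

theorem sum_row (h : IsCubic v) (i k : Fin n) :
    ∑ l, v i l * v k l = if i = k then 1 else 0 := (isCubic_iff_sum.1 h).2.1 i k

theorem sum_col (h : IsCubic v) (i k : Fin n) :
    ∑ l, v l i * v l k = if i = k then 1 else 0 := (isCubic_iff_sum.1 h).2.2.1 i k

theorem transpose (h : IsCubic v) : IsCubic v.transpose where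
  selfAdjoint i k := h.selfAdjoint k i
  mul_transpose := by simpa using h.transpose_mul
  transpose_mul := by simpa using h.mul_transpose
  row i k l hkl := h.col i k l hkl
  col i k l hkl := h.row i k l hkl

theorem map (h : IsCubic v) (f : B →⋆ₐ[ℂ] B') : IsCubic (fun i k => f (v i k)) := by
  refine isCubic_iff_sum.2 ⟨fun i k => ?_, fun i k => ?_, fun i k => ?_, fun i k l hkl => ?_,
    fun i k l hkl => ?_⟩
  · rw [← map_star, h.selfAdjoint]
  · simp_rw [← map_mul, ← map_sum, h.sum_row]
    split_ifs <;> simp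
  · simp_rw [← map_mul, ← map_sum, h.sum_col]
    split_ifs <;> simp
  · rw [← map_mul, h.row i k l hkl, map_zero]
  · rw [← map_mul, h.col i k l hkl, map_zero]

theorem of_map (f : B →⋆ₐ[ℂ] B') (hf : Function.Injective f)
    (h : IsCubic (fun i k => f (v i k) : Matrix (Fin n) (Fin n) B')) : IsCubic v := by
  refine isCubic_iff_sum.2 ⟨fun i k => hf ?_, fun i k => hf ?_, fun i k => hf ?_,
    fun i k l hkl => hf ?_, fun i k l hkl => hf ?_⟩
  · rw [map_star, h.selfAdjoint i k]
  · have := h.sum_row i k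
    simp_rw [map_sum, map_mul, this]
    split_ifs <;> simp
  · have := h.sum_col i k
    simp_rw [map_sum, map_mul, this]
    split_ifs <;> simp
  · rw [map_mul, h.row i k l hkl, map_zero]
  · rw [map_mul, h.col i k l hkl, map_zero]

/-- Multiply ∑ v_lk² = 1 by v_ik: column orthogonality leaves only l = i. -/
theorem mul_self_mul_self (h : IsCubic v) (i k : Fin n) : v i k * v i k * v i k = v i k := by
  have h1 : (∑ l, v l k * v l k) * v i k = v i k := by simp [h.sum_col]
  rw [Finset.sum_mul, Finset.sum_eq_single i] at h1
  · exact h1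
  · intro l _ hl
    rw [mul_assoc, h.col k l i hl, mul_zero]
  · simp

/-- The square of an entry is a projection. This bound is what makes the universal C*-seminorm
finite. -/
theorem norm_le (h : IsCubic v) (i k : Fin n) : ‖v i k‖ ≤ 1 := by
  have h1 : ‖v i k * v i k‖ ≤ 1 := by
    refine norm_le_one_of_star_mul_self ?_
    rw [star_mul, h.selfAdjoint, ← mul_assoc, h.mul_self_mul_self]
  have h2 := CStarRing.norm_star_mul_self (x := v i k)
  rw [h.selfAdjoint] at h2
  by_contra! h3
  nlinarith

theorem one : IsCubic (1 : Matrix (Fin n) (Fin n) B) where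
  selfAdjoint i k := by
    rw [Matrix.one_apply]
    split_ifs <;> simp
  mul_transpose := by simp
  transpose_mul := by simp
  row i k l hkl := by
    simp only [Matrix.one_apply]
    split_ifs with h1 h2 <;> simp
    exact (hkl (h1.symm.trans h2)).elim
  col i k l hkl := by
    simp only [Matrix.one_apply]
    split_ifs with h1 h2 <;> simp
    exact (hkl (h1.trans h2.symm)).elim

/-- The orthogonality relations on the rows follow from those on the columns. -/
theorem of_col (h1 : ∀ i k, star (v i k) = v i k)
    (h2 : ∀ i k, ∑ l, v i l * v k l = if i = k then 1 else 0)
    (h3 : ∀ i k, ∑ l, v l i * v l k = if i = k then 1 else 0)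
    (h4 : ∀ i k l, k ≠ l → v k i * v l i = 0) : IsCubic v := by
  have cube : ∀ i k, v i k * v i k * v i k = v i k := by
    intro i k
    have h5 : (∑ l, v l k * v l k) * v i k = v i k := by simp [h3]
    rw [Finset.sum_mul, Finset.sum_eq_single i] at h5
    · exact h5
    · intro l _ hl
      rw [mul_assoc, h4 k l i hl, mul_zero]
    · simp
  refine isCubic_iff_sum.2 ⟨h1, h2, h3, fun i k l hkl => ?_, h4⟩
  -- The squares in a row are projections with sum 1, hence orthogonal. The cube relation then turns
  -- v_ik v_il into v_ik (v_ik² v_il²) v_il.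
  have h6 : v i k * v i k * (v i l * v i l) = 0 :=
    mul_eq_zero_of_sum_projections (p := fun l => v i l * v i l) (fun l => by simp [h1])
      (fun l => by rw [← mul_assoc, cube]) (by simp [h2]) hkl
  calc v i k * v i l = v i k * (v i k * v i k * (v i l * v i l)) * v i l := by
        conv_lhs => rw [← cube i k, ← cube i l]
        simp only [mul_assoc]
    _ = 0 := by rw [h6, mul_zero, zero_mul]

end IsCubic

open ComplexStarModule in
/-- The universal C*-algebra generated by a cubic matrix and a unitary; under the assumption `q`, the
unitary is moreover required to be trivial. -/
theorem exists_universal_cubic (n : ℕ) (q : Prop) :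
    ∃ (U : Type u) (_ : CStarAlgebra U) (v : Matrix (Fin n) (Fin n) U) (a : U),
      Nontrivial U ∧ IsCubic v ∧ a ∈ unitary U ∧ (q → a = 1) ∧
      (∀ (B : Type u) [CStarAlgebra B] (w : Matrix (Fin n) (Fin n) B) (b : B),
        IsCubic w → b ∈ unitary B → (q → b = 1) →
        ∃ f : U →⋆ₐ[ℂ] B, (∀ i k, f (v i k) = w i k) ∧ f a = b) ∧
      ∀ (B : Type u) [CStarAlgebra B] (f f' : U →⋆ₐ[ℂ] B),
        (∀ i k, f (v i k) = f' (v i k)) → f a = f' a → f = f' := by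
  -- All free generators are self-adjoint, so the unitary is encoded by two of them, its real and
  -- imaginary parts.
  let X := ULift.{u} ((Fin n × Fin n) ⊕ Bool)
  let xm : Fin n → Fin n → X := fun i k => ⟨.inl (i, k)⟩
  let xr : X := ⟨.inr true⟩
  let xi : X := ⟨.inr false⟩
  let R : ∀ (B : Type u) [CStarAlgebra B], (X → B) → Prop := fun B _ w =>
    IsCubic (fun i k => w (xm i k)) ∧ w xr + Complex.I • w xi ∈ unitary B ∧
      (q → w xr + Complex.I • w xi = 1)
  have key : ∀ (B : Type u) [CStarAlgebra B] (w : Matrix (Fin n) (Fin n) B) (b : B),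
      IsCubic w → b ∈ unitary B → (q → b = 1) →
      ∃ w' : X → B, IsAdmissible R w' ∧ (∀ i k, w' (xm i k) = w i k) ∧
        w' xr + Complex.I • w' xi = b := by
    intro B _ w b hw hb hq
    let w' : X → B := fun x => Sum.elim (fun ik => w ik.1 ik.2)
      (fun c => if c then (realPart b : B) else (imaginaryPart b : B)) x.down
    have hb1 := norm_le_one_of_mem_unitary hb
    have hw' : w' xr + Complex.I • w' xi = b := realPart_add_I_smul_imaginaryPart b
    refine ⟨w', ⟨?_, ?_, hw, ?_, ?_⟩, fun i k => rfl, hw'⟩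
    · rintro ⟨⟨i, k⟩ | _ | _⟩
      · exact hw.selfAdjoint i k
      · exact (imaginaryPart b).2
      · exact (realPart b).2
    · rintro ⟨⟨i, k⟩ | _ | _⟩
      · exact hw.norm_le i k
      · exact (imaginaryPart.norm_le b).trans hb1
      · exact (realPart.norm_le b).trans hb1
    · rw [hw']
      exact hb
    · rw [hw']
      exact hq
  -- The identity matrix and the unitary 1 in a copy of ℂ provide an admissible family. The
  -- resulting character also shows that the universal algebra is nontrivial.
  have triv : ∃ (w : X → (PUnit.{u + 1} → ℂ)), IsAdmissible R w := by
    obtain ⟨w', h, -⟩ := key (PUnit.{u + 1} → ℂ) 1 1 .one (one_mem _) fun _ => rfl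
    exact ⟨w', h⟩
  obtain ⟨w₀, hw₀⟩ := triv
  obtain ⟨U, _, g, hg, h1, h2, h3⟩ := exists_universal R ⟨_, _, w₀, hw₀⟩
  have h4 : ∀ {a b : U} (x y : FreeStarAlgebra X), FreeStarAlgebra.eval g hg x = a →
      FreeStarAlgebra.eval g hg y = b →
      (∀ (B : Type u) [CStarAlgebra B] (w : X → B) (hw : IsAdmissible R w),
        FreeStarAlgebra.eval w hw.selfAdjoint x = FreeStarAlgebra.eval w hw.selfAdjoint y) →
      a = b := by
    rintro _ _ x y rfl rfl h
    exact h3 x y h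
  have hcubic : IsCubic (fun i k => g (xm i k)) := by
    refine isCubic_iff_sum.2 ⟨fun i k => hg _, fun i k => ?_, fun i k => ?_, fun i k l hkl => ?_,
      fun i k l hkl => ?_⟩
    · refine h4 (∑ l, FreeStarAlgebra.var (xm i l) * FreeStarAlgebra.var (xm k l))
        (if i = k then 1 else 0) (by simp) (by split_ifs <;> simp) fun B _ w hw => ?_
      have := hw.rel.1.sum_row i k
      simp only [map_sum, map_mul, FreeStarAlgebra.eval_var, this]
      split_ifs <;> simp
    · refine h4 (∑ l, FreeStarAlgebra.var (xm l i) * FreeStarAlgebra.var (xm l k))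
        (if i = k then 1 else 0) (by simp) (by split_ifs <;> simp) fun B _ w hw => ?_
      have := hw.rel.1.sum_col i k
      simp only [map_sum, map_mul, FreeStarAlgebra.eval_var, this]
      split_ifs <;> simp
    · refine h4 (FreeStarAlgebra.var (xm i k) * FreeStarAlgebra.var (xm i l)) 0
        (by simp) (by simp) fun B _ w hw => ?_
      simpa using hw.rel.1.row i k l hkl
    · refine h4 (FreeStarAlgebra.var (xm k i) * FreeStarAlgebra.var (xm l i)) 0
        (by simp) (by simp) fun B _ w hw => ?_
      simpa using hw.rel.1.col i k l hkl
  let y : FreeStarAlgebra X := FreeStarAlgebra.var xr + Complex.I • FreeStarAlgebra.var xi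
  have hy : FreeStarAlgebra.eval g hg y = g xr + Complex.I • g xi := by simp [y]
  refine ⟨U, ‹_›, fun i k => g (xm i k), g xr + Complex.I • g xi, ?_, hcubic, ?_, ?_, ?_, ?_⟩
  · obtain ⟨f, -⟩ := h1 _ w₀ hw₀
    exact f.toAlgHom.toRingHom.domain_nontrivial
  · rw [Unitary.mem_iff]
    constructor
    · refine h4 (star y * y) 1 (by simp [map_star, hy]) (by simp) fun B _ w hw => ?_
      have := Unitary.star_mul_self_of_mem hw.rel.2.1
      simpa [y, map_star] using this
    · refine h4 (y * star y) 1 (by simp [map_star, hy]) (by simp) fun B _ w hw => ?_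
      have := Unitary.mul_star_self_of_mem hw.rel.2.1
      simpa [y, map_star] using this
  · intro hq
    refine h4 y 1 hy (by simp) fun B _ w hw => ?_
    simpa [y] using hw.rel.2.2 hq
  · intro B _ w b hw hb hq
    obtain ⟨w', hw', h5, h6⟩ := key B w b hw hb hq
    obtain ⟨f, hf⟩ := h1 B w' hw'
    refine ⟨f, fun i k => by rw [hf, h5], ?_⟩
    rw [map_add, map_smul, hf, hf, h6]
  · intro B _ f f' h5 h6
    refine h2 B f f' ?_
    -- Both generators hidden in the unitary are recovered from it, so agreement on the unitary
    -- gives agreement on them.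
    have h7 : ∀ f : U →⋆ₐ[ℂ] B, f (g xr) = realPart (f (g xr + Complex.I • g xi)) := by
      intro f
      have e1 : star (f (g xr)) = f (g xr) := by rw [← map_star, hg]
      have e2 : star (f (g xi)) = f (g xi) := by rw [← map_star, hg]
      rw [realPart_apply_coe, map_add, map_smul, star_add, star_smul, e1, e2]
      have e3 : ∀ x t : B, x = (2⁻¹ : ℝ) • (x + t + (x + -t)) := fun x t => by
        rw [show x + t + (x + -t) = (2 : ℝ) • x by rw [two_smul]; abel, smul_smul]
        norm_num
      simpa using e3 (f (g xr)) (Complex.I • f (g xi))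
    have h8 : ∀ f : U →⋆ₐ[ℂ] B,
        f (g xi) = (-Complex.I) • (f (g xr + Complex.I • g xi) - f (g xr)) := by
      intro f
      simp [smul_smul]
    have h9 : f (g xr) = f' (g xr) := by rw [h7 f, h7 f', h6]
    rintro ⟨⟨i, k⟩ | _ | _⟩
    · exact h5 i k
    · change f (g xi) = f' (g xi)
      rw [h8 f, h8 f', h6, h9]
    · exact h9

end Cubic
end
end QuantumIsometry

namespace QuantumIsometry
noncomputable section

/-! ### Reduced words in the free product of copies of `ℤ₂` -/

section Words

variable {n : ℕ}

@[simp]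
theorem gen_mul_self (i : Fin n) : gen i * gen i = 1 := by
  rw [gen, ← map_mul]
  have : (Multiplicative.ofAdd (1 : ZMod 2)) * Multiplicative.ofAdd 1 = 1 := by decide
  rw [this, map_one]

@[simp]
theorem gen_mul_gen_mul (i : Fin n) (x : FreePowerZ2 n) : gen i * (gen i * x) = x := by
  rw [← mul_assoc, gen_mul_self, one_mul]

@[simp]
theorem gen_inv (i : Fin n) : (gen i)⁻¹ = gen i := inv_eq_of_mul_eq_one_left (gen_mul_self i)

/-- The indices of the letters of the reduced word of an element. -/
def red (x : FreePowerZ2 n) : List (Fin n) := (Monoid.CoprodI.Word.equiv x).toList.map Sigma.fst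

theorem red_prod (w : Monoid.CoprodI.Word (fun _ : Fin n => Multiplicative (ZMod 2))) :
    red w.prod = w.toList.map Sigma.fst := by
  have : Monoid.CoprodI.Word.equiv w.prod = w := Monoid.CoprodI.Word.equiv.apply_symm_apply w
  rw [red, this]

@[simp]
theorem red_one : red (1 : FreePowerZ2 n) = [] := by
  rw [← Monoid.CoprodI.Word.prod_empty, red_prod]
  rfl

theorem eq_ofAdd_one {m : Multiplicative (ZMod 2)} (hm : m ≠ 1) : m = Multiplicative.ofAdd 1 := by
  revert m
  decide

theorem head_red_prod (w : Monoid.CoprodI.Word (fun _ : Fin n => Multiplicative (ZMod 2))) :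
    (red w.prod).head? = w.fstIdx := by
  rw [red_prod, List.head?_map]
  rfl

theorem red_gen_mul {i : Fin n} {x : FreePowerZ2 n} (h : (red x).head? ≠ some i) :
    red (gen i * x) = i :: red x := by
  obtain ⟨w, rfl⟩ : ∃ w : Monoid.CoprodI.Word (fun _ : Fin n => Multiplicative (ZMod 2)),
      w.prod = x := ⟨_, Monoid.CoprodI.Word.equiv.symm_apply_apply x⟩
  rw [head_red_prod] at h
  have h1 : (Multiplicative.ofAdd (1 : ZMod 2)) ≠ 1 := by decide
  have := red_prod (Monoid.CoprodI.Word.cons (Multiplicative.ofAdd 1) w h h1)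
  rw [Monoid.CoprodI.Word.prod_cons] at this
  rw [gen, this, red_prod]
  rfl

/-- Induction on the reduced word. -/
theorem red_induction {P : FreePowerZ2 n → Prop} (one : P 1)
    (mul : ∀ i x, (red x).head? ≠ some i → P x → P (gen i * x)) (x : FreePowerZ2 n) : P x := by
  obtain ⟨w, rfl⟩ : ∃ w : Monoid.CoprodI.Word (fun _ : Fin n => Multiplicative (ZMod 2)),
      w.prod = x := ⟨_, Monoid.CoprodI.Word.equiv.symm_apply_apply x⟩
  induction w using Monoid.CoprodI.Word.consRecOn with
  | empty => simpa using one
  | cons i m w h1 h2 ih =>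
    rw [Monoid.CoprodI.Word.prod_cons, eq_ofAdd_one h2]
    exact mul i _ (by rwa [head_red_prod]) ih

theorem exists_of_red_eq_cons {x : FreePowerZ2 n} {i : Fin n} {l : List (Fin n)}
    (h : red x = i :: l) :
    ∃ y, x = gen i * y ∧ red y = l ∧ (red y).head? ≠ some i := by
  revert h
  refine red_induction (P := fun x => red x = i :: l →
    ∃ y, x = gen i * y ∧ red y = l ∧ (red y).head? ≠ some i) (by simp) (fun k y hy _ h => ?_) x
  rw [red_gen_mul hy] at h
  obtain ⟨rfl, rfl⟩ := List.cons.inj h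
  exact ⟨y, rfl, rfl, hy⟩

theorem red_gen_mul_of_eq_cons {x : FreePowerZ2 n} {i : Fin n} {l : List (Fin n)}
    (h : red x = i :: l) : red (gen i * x) = l := by
  obtain ⟨y, rfl, hy, -⟩ := exists_of_red_eq_cons h
  rwa [gen_mul_gen_mul]

theorem prod_red (x : FreePowerZ2 n) : ((red x).map gen).prod = x := by
  refine red_induction (P := fun x => ((red x).map gen).prod = x) (by simp) (fun i x h hx => ?_) x
  rw [red_gen_mul h, List.map_cons, List.prod_cons, hx]

theorem red_injective : Function.Injective (red (n := n)) := fun x y h => by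
  rw [← prod_red x, h, prod_red]

@[simp]
theorem red_gen (i : Fin n) : red (gen i) = [i] := by
  simpa using red_gen_mul (i := i) (x := 1) (by simp)

theorem gen_injective : Function.Injective (gen (n := n)) := fun i k h => by
  simpa using congrArg red h

theorem length_red_gen_mul_le (i : Fin n) (x : FreePowerZ2 n) :
    (red (gen i * x)).length ≤ (red x).length + 1 := by
  by_cases h : (red x).head? = some i
  · obtain ⟨l, hl⟩ := List.head?_eq_some_iff.1 h
    rw [red_gen_mul_of_eq_cons hl, hl, List.length_cons]
    omega
  · rw [red_gen_mul h, List.length_cons]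

/-- Multiplying by one generator lengthens the reduced word by at most one letter, so no expression
is shorter than the reduced word. -/
theorem wordLength_eq (x : FreePowerZ2 n) : wordLength (Set.range gen) x = (red x).length := by
  refine le_antisymm (Nat.sInf_le ⟨(red x).map gen, by simp, by simp, prod_red x⟩) ?_
  refine le_csInf ⟨_, (red x).map gen, rfl, by simp, prod_red x⟩ ?_
  rintro _ ⟨w, rfl, hw, rfl⟩
  induction w with
  | nil => simp
  | cons g w ih =>
    obtain ⟨i, rfl⟩ := hw g (by simp)
    have := ih fun h hh => hw h (by simp [hh])
    have := length_red_gen_mul_le i w.prod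
    simp only [List.prod_cons, List.length_cons]
    omega

/-- The eigenspaces of D are finite dimensional; this reduces the series over Γ to finite sums. -/
theorem finite_length_red_eq (r : ℕ) : {x : FreePowerZ2 n | (red x).length = r}.Finite :=
  (List.finite_length_eq (Fin n) r).preimage red_injective.injOn

theorem length_red_eq_zero_iff {x : FreePowerZ2 n} : (red x).length = 0 ↔ x = 1 := by
  rw [List.length_eq_zero_iff, ← red_one, red_injective.eq_iff]

theorem length_red_eq_one_iff {x : FreePowerZ2 n} : (red x).length = 1 ↔ ∃ i, x = gen i := by
  rw [List.length_eq_one_iff]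
  refine exists_congr fun i => ?_
  rw [← red_gen, red_injective.eq_iff]

end Words

/-! ### The coefficients of the action defined by a matrix -/

section Coeff

variable {n : ℕ} {B B' : Type*}

/-- The products of the entries of a matrix along two words of the same length. -/
def wordCoeff [Ring B] (v : Matrix (Fin n) (Fin n) B) : List (Fin n) → List (Fin n) → B
  | [], [] => 1
  | k :: l, i :: m => v k i * wordCoeff v l m
  | [], _ :: _ => 0
  | _ :: _, [] => 0

/-- The coefficients of the action on the group algebra which is defined on the generators by a
matrix. -/
def coeff [Ring B] (v : Matrix (Fin n) (Fin n) B) (x y : FreePowerZ2 n) : B :=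
  wordCoeff v (red x) (red y)

section Ring

variable [Ring B] [Ring B'] (v : Matrix (Fin n) (Fin n) B)

theorem wordCoeff_eq_zero : ∀ {l m : List (Fin n)}, l.length ≠ m.length → wordCoeff v l m = 0
  | [], [], h => (h rfl).elim
  | k :: l, i :: m, h => by
    rw [wordCoeff, wordCoeff_eq_zero (by simpa using h), mul_zero]
  | [], _ :: _, _ => rfl
  | _ :: _, [], _ => rfl

theorem coeff_eq_zero {x y : FreePowerZ2 n} (h : (red x).length ≠ (red y).length) :
    coeff v x y = 0 := wordCoeff_eq_zero v h

theorem coeff_one (x : FreePowerZ2 n) [Decidable (x = 1)] :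
    coeff v x 1 = if x = 1 then 1 else 0 := by
  split_ifs with h
  · subst h
    simp [coeff, wordCoeff]
  · refine coeff_eq_zero v fun h' => h ?_
    rwa [red_one, List.length_nil, length_red_eq_zero_iff] at h'

@[simp]
theorem coeff_gen_gen (k i : Fin n) : coeff v (gen k) (gen i) = v k i := by
  simp [coeff, wordCoeff]

theorem map_coeff {F : Type*} [FunLike F B B'] [RingHomClass F B B'] (f : F)
    (x y : FreePowerZ2 n) : f (coeff v x y) = coeff (fun i k => f (v i k)) x y := by
  have : ∀ l m, f (wordCoeff v l m) = wordCoeff (fun i k => f (v i k)) l m := by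
    intro l m
    induction l generalizing m with
    | nil => cases m <;> simp [wordCoeff]
    | cons k l ih => cases m <;> simp [wordCoeff, ih]
  exact this _ _

theorem coeff_transpose (x y : FreePowerZ2 n) : coeff v.transpose x y = coeff v y x := by
  have : ∀ l m, wordCoeff v.transpose l m = wordCoeff v m l := by
    intro l m
    induction l generalizing m with
    | nil => cases m <;> simp [wordCoeff]
    | cons k l ih => cases m <;> simp [wordCoeff, ih]
  exact this _ _

theorem coeff_one_left (y : FreePowerZ2 n) [Decidable (y = 1)] :
    coeff v 1 y = if y = 1 then 1 else 0 := by
  rw [← coeff_transpose, coeff_one]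

end Ring

/-! ### Multiplicativity and unitarity of the coefficients -/

namespace IsCubic

variable [CStarAlgebra B] [CStarAlgebra B'] {v : Matrix (Fin n) (Fin n) B}

theorem mul_wordCoeff_cons (hv : IsCubic v) {i k : Fin n} {l : List (Fin n)}
    {y : FreePowerZ2 n} (h : (red y).head? ≠ some i) :
    v k i * wordCoeff v (k :: l) (red y) = 0 := by
  cases hy : red y with
  | nil => simp [wordCoeff]
  | cons i' m =>
    rw [hy, List.head?_cons, Ne, Option.some_inj] at h
    rw [wordCoeff, ← mul_assoc, hv.row k i i' (Ne.symm h), zero_mul]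

/-- This is α(g_i y) = α(g_i)α(y), read at x, and is the recursion behind all later inductions. If
g_i y is reduced, the row relations kill every term but the one that strips the first letter of x.
If it cancels, the column relations and ∑ v_ki² = 1 are used. -/
theorem coeff_gen_mul (hv : IsCubic v) (i : Fin n) (x y : FreePowerZ2 n) :
    coeff v x (gen i * y) = ∑ k, v k i * coeff v (gen k * x) y := by
  have main : ∀ (x y : FreePowerZ2 n), (red y).head? ≠ some i →
      coeff v x (gen i * y) = ∑ k, v k i * coeff v (gen k * x) y := by
    intro x y h
    have zero : ∀ k, (red x).head? ≠ some k → v k i * coeff v (gen k * x) y = 0 := by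
      intro k hk
      rw [coeff, red_gen_mul hk]
      exact hv.mul_wordCoeff_cons h
    rw [coeff, red_gen_mul h]
    cases hx : red x with
    | nil =>
      rw [Finset.sum_eq_zero fun k _ => zero k (by simp [hx])]
      rfl
    | cons j l =>
      rw [Finset.sum_eq_single j]
      · rw [coeff, red_gen_mul_of_eq_cons hx]
        rfl
      · intro k _ hk
        refine zero k ?_
        simpa [hx] using Ne.symm hk
      · simp
  by_cases h : (red y).head? = some i
  · obtain ⟨m, hm⟩ := List.head?_eq_some_iff.1 h
    obtain ⟨y, rfl, -, hy⟩ := exists_of_red_eq_cons hm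
    -- Expanding the right-hand side by the reduced case gives a double sum over v_ki v_li, where
    -- only l = k survives.
    simp_rw [gen_mul_gen_mul, main _ y hy, Finset.mul_sum, ← mul_assoc]
    have : ∀ k, ∑ l, v k i * v l i * coeff v (gen l * gen k * x) y
        = v k i * v k i * coeff v x y := by
      intro k
      rw [Finset.sum_eq_single k]
      · simp
      · intro l _ hl
        rw [hv.col i k l (Ne.symm hl), zero_mul]
      · simp
    simp [this, ← Finset.sum_mul, hv.sum_col]
  · exact main x y h

/-- The recursion on the last letter is needed because the adjoint reverses words. -/
theorem coeff_mul_gen (hv : IsCubic v) (i : Fin n) (x y : FreePowerZ2 n) :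
    coeff v x (y * gen i) = ∑ k, coeff v (x * gen k) y * v k i := by
  classical
  induction y using red_induction generalizing x with
  | one =>
    have := hv.coeff_gen_mul i x 1
    rw [mul_one] at this
    rw [one_mul, this]
    refine Finset.sum_congr rfl fun k _ => ?_
    have : gen k * x = 1 ↔ x * gen k = 1 := by
      rw [mul_eq_one_iff_inv_eq, mul_eq_one_iff_eq_inv, gen_inv, eq_comm]
    simp [coeff_one, this]
  | mul j y h ih =>
    simp_rw [mul_assoc, hv.coeff_gen_mul j, ih, Finset.mul_sum, Finset.sum_mul]
    rw [Finset.sum_comm]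
    simp_rw [mul_assoc]

theorem star_coeff (hv : IsCubic v) (x y : FreePowerZ2 n) :
    star (coeff v x y) = coeff v x⁻¹ y⁻¹ := by
  classical
  induction y using red_induction generalizing x with
  | one =>
    rw [inv_one, coeff_one, coeff_one]
    simp only [inv_eq_one]
    split_ifs <;> simp
  | mul i y h ih =>
    rw [mul_inv_rev, gen_inv, hv.coeff_mul_gen, hv.coeff_gen_mul, star_sum]
    refine Finset.sum_congr rfl fun k _ => ?_
    rw [star_mul, hv.selfAdjoint, ih, mul_inv_rev, gen_inv]

/-- The coefficient at x of α(y)α(z) = α(yz). -/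
theorem hasSum_coeff_mul (hv : IsCubic v) (x y z : FreePowerZ2 n) :
    HasSum (fun w => coeff v w y * coeff v (w⁻¹ * x) z) (coeff v x (y * z)) := by
  classical
  induction y using red_induction generalizing x with
  | one =>
    convert hasSum_ite_eq (1 : FreePowerZ2 n) (coeff v x z) using 2 with w
    · rw [coeff_one]
      split_ifs with h <;> simp [h]
    · rw [one_mul]
  | mul i y h ih =>
    simp_rw [mul_assoc, hv.coeff_gen_mul i, Finset.sum_mul]
    refine hasSum_sum fun k _ => ?_
    rw [← (Equiv.mulLeft (gen k)).hasSum_iff]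
    refine ((ih (gen k * x)).mul_left (v k i)).congr_fun fun w => ?_
    simp [mul_assoc]

/-- The coefficient at 1 of α(x⁻¹)α(y) = α(x⁻¹y). The companion identity for rows is the same
statement for the transpose, which is again cubic. -/
theorem hasSum_star_coeff_mul (hv : IsCubic v) (x y : FreePowerZ2 n) [Decidable (x = y)] :
    HasSum (fun z => star (coeff v z x) * coeff v z y) (if x = y then 1 else 0) := by
  have := hv.hasSum_coeff_mul 1 x⁻¹ y
  rw [← (Equiv.inv (FreePowerZ2 n)).hasSum_iff] at this
  convert this using 2 with z
  · simp [hv.star_coeff]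
  · rw [coeff_one_left]
    simp [inv_mul_eq_one]

theorem hasSum_coeff_mul_star (hv : IsCubic v) (x y : FreePowerZ2 n) [Decidable (x = y)] :
    HasSum (fun z => coeff v x z * star (coeff v y z)) (if x = y then 1 else 0) := by
  have := hv.transpose.hasSum_coeff_mul 1 x y⁻¹
  convert this using 2 with z
  · simp [hv.star_coeff, coeff_transpose]
  · rw [coeff_one_left]
    simp [mul_inv_eq_one]

/-- The coefficients of the conjugate of a left translation by the unitary which implements the
action. -/
theorem hasSum_coeff_mul_star_coeff (hv : IsCubic v) (γ x y : FreePowerZ2 n) :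
    HasSum (fun z => coeff v x (γ * z) * star (coeff v y z)) (coeff v (x * y⁻¹) γ) := by
  classical
  induction γ using red_induction generalizing x with
  | one => simpa [coeff_one, mul_inv_eq_one] using hv.hasSum_coeff_mul_star x y
  | mul i γ h ih =>
    simp_rw [mul_assoc, hv.coeff_gen_mul i, Finset.sum_mul]
    refine hasSum_sum fun k _ => ?_
    simpa [mul_assoc] using (ih (gen k * x)).mul_left (v k i)

end IsCubic

/-- The recursion on the first letter determines everything from the column of 1; this identifies an
abstract U with the word coefficients. -/
theorem coeff_unique [Ring B] {v : Matrix (Fin n) (Fin n) B} {c d : FreePowerZ2 n → FreePowerZ2 n → B}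
    (h1 : ∀ x, c x 1 = d x 1)
    (hc : ∀ i x y, c x (gen i * y) = ∑ k, v k i * c (gen k * x) y)
    (hd : ∀ i x y, d x (gen i * y) = ∑ k, v k i * d (gen k * x) y)
    (x y : FreePowerZ2 n) : c x y = d x y := by
  induction y using red_induction generalizing x with
  | one => exact h1 x
  | mul i y h ih => simp_rw [hc, hd, ih]

/-- Δ is multiplicative and v is a representation, so the recursion propagates the comultiplication
formula from letters to words. -/
theorem hasSum_comul_coeff {A T : Type*} [CStarAlgebra A] [CStarAlgebra T]
    {v : Matrix (Fin n) (Fin n) A} (hv : IsCubic v) (j : A ⊗[ℂ] A →⋆ₐ[ℂ] T) (Δ : A →⋆ₐ[ℂ] T)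
    (hΔ : ∀ i k, Δ (v i k) = ∑ l, j (v i l ⊗ₜ[ℂ] v l k)) (x y : FreePowerZ2 n) :
    HasSum (fun z => j (coeff v x z ⊗ₜ[ℂ] coeff v z y)) (Δ (coeff v x y)) := by
  classical
  induction y using red_induction generalizing x with
  | one =>
    convert hasSum_ite_eq (1 : FreePowerZ2 n) (Δ (coeff v x 1)) using 2 with z
    rw [coeff_one v z]
    split_ifs with h
    · subst h
      rw [coeff_one]
      split_ifs <;> simp [← Algebra.TensorProduct.one_def]
    · simp
  | mul i y h ih =>
    have h1 : ∀ l, HasSum (fun z => j (coeff v x z ⊗ₜ[ℂ] (v l i * coeff v (gen l * z) y)))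
        (∑ k, j (v k l ⊗ₜ[ℂ] v l i) * Δ (coeff v (gen k * x) y)) := by
      intro l
      rw [← (Equiv.mulLeft (gen l)).hasSum_iff]
      refine (hasSum_sum fun k (_ : k ∈ Finset.univ) =>
        (ih (gen k * x)).mul_left (j (v k l ⊗ₜ[ℂ] v l i))).congr_fun fun z => ?_
      simp_rw [← map_mul, Algebra.TensorProduct.tmul_mul_tmul, ← map_sum, ← TensorProduct.sum_tmul]
      simp [hv.coeff_gen_mul]
    convert hasSum_sum fun l (_ : l ∈ Finset.univ) => h1 l using 2 with z
    · rw [hv.coeff_gen_mul, TensorProduct.tmul_sum, map_sum]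
    · rw [hv.coeff_gen_mul, map_sum, Finset.sum_comm]
      refine Finset.sum_congr rfl fun k _ => ?_
      rw [map_mul, hΔ, Finset.sum_mul]

end Coeff
end
end QuantumIsometry

namespace QuantumIsometry
noncomputable section

/-! ### Translations on `ℓ²(Γ)` -/

section Translations

variable {Γ : Type*}

/-- The operator on `ℓ²(Γ)` defined by a permutation. -/
def permOp (e : Equiv.Perm Γ) : lp (fun _ : Γ => ℂ) 2 →L[ℂ] lp (fun _ : Γ => ℂ) 2 :=
  LinearMap.mkContinuous
    { toFun := fun f => ⟨fun x => f (e x), by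
        have h := (memℓp_gen_iff (p := 2) (by simp)).1 (lp.memℓp f)
        exact (memℓp_gen_iff (p := 2) (by simp)).2 (h.comp_injective e.injective)⟩
      map_add' := fun f g => rfl
      map_smul' := fun c f => rfl } 1 fun f => by
    rw [lp.norm_eq_tsum_rpow (by simp), lp.norm_eq_tsum_rpow (by simp), one_mul]
    exact (congrArg (· ^ _) (e.tsum_eq fun x => ‖f x‖ ^ (2 : ENNReal).toReal)).le

@[simp]
theorem permOp_apply (e : Equiv.Perm Γ) (f : lp (fun _ : Γ => ℂ) 2) (x : Γ) :
    permOp e f x = f (e x) := rfl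

theorem delta_apply (g x : Γ) [Decidable (x = g)] : delta g x = if x = g then 1 else 0 := by
  classical
  rw [delta, lp.single_apply, Pi.single_apply]
  congr

@[simp]
theorem permOp_delta (e : Equiv.Perm Γ) (g : Γ) : permOp e (delta g) = delta (e.symm g) := by
  classical
  ext x
  simp [delta_apply, Equiv.eq_symm_apply]

theorem inner_delta_left (g : Γ) (f : lp (fun _ : Γ => ℂ) 2) : inner ℂ (delta g) f = f g := by
  classical
  rw [delta, lp.inner_single_left]
  simp

theorem ext_delta {L M : lp (fun _ : Γ => ℂ) 2 →L[ℂ] lp (fun _ : Γ => ℂ) 2}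
    (h : ∀ g, L (delta g) = M (delta g)) : L = M := by
  classical
  refine lp.ext_continuousLinearMap (by simp) fun g => ?_
  ext1
  convert h g <;> simp [delta]

variable [Group Γ]

/-- `permOp` composes functions with the permutation, hence moves basis vectors by its inverse;
whence g⁻¹. -/
theorem permOp_mulLeft_mem (g : Γ) : permOp (Equiv.mulLeft g⁻¹) ∈ leftRegular Γ :=
  ⟨g, fun h => by simp⟩

theorem permOp_mulRight_mem (k : Γ) :
    permOp (Equiv.mulRight k) ∈ Set.centralizer (leftRegular Γ) := by
  rintro L ⟨g, hL⟩
  refine ext_delta fun h => ?_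
  simp [hL, mul_assoc]

/-- The matrix of an element of the bicommutant is invariant under right translations. -/
theorem bicommutant_apply_mul {L : lp (fun _ : Γ => ℂ) 2 →L[ℂ] lp (fun _ : Γ => ℂ) 2}
    (hL : L ∈ Set.centralizer (Set.centralizer (leftRegular Γ))) (g h k : Γ) :
    L (delta (h * k)) (g * k) = L (delta h) g := by
  have h1 := hL _ (permOp_mulRight_mem k)
  have h2 := congrArg (fun f : lp (fun _ : Γ => ℂ) 2 => f g) (DFunLike.congr_fun h1 (delta (h * k)))
  simpa using h2

/-- The operator with matrix `f (g h⁻¹)`, for a finitely supported function `f`, belongs to the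
bicommutant. -/
theorem exists_mem_bicommutant (f : Γ → ℂ) (s : Finset Γ) (hf : ∀ x, x ∉ s → f x = 0) :
    ∃ L ∈ Set.centralizer (Set.centralizer (leftRegular Γ)),
      ∀ g h, inner ℂ (delta g) (L (delta h)) = f (g * h⁻¹) := by
  classical
  refine ⟨∑ x ∈ s, f x • permOp (Equiv.mulLeft x⁻¹), fun M hM => ?_, fun g h => ?_⟩
  · simp_rw [Finset.mul_sum, Finset.sum_mul, mul_smul_comm, smul_mul_assoc,
      hM _ (permOp_mulLeft_mem _)]
  · rw [sum_apply, inner_sum]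
    simp only [smul_apply, inner_smul_right, inner_delta_left, permOp_apply,
      delta_apply, Equiv.coe_mulLeft, inv_mul_eq_iff_eq_mul, ← mul_inv_eq_iff_eq_mul, mul_ite,
      mul_one, mul_zero, Finset.sum_ite_eq]
    split_ifs with hs
    · rfl
    · exact (hf _ hs).symm

end Translations

/-! ### The orientation preserving action defined by a cubic matrix -/

section Action

variable {n : ℕ} {G : CompactQuantumGroup.{u}}

/-- The unitary on `ℓ²(Γ)` defined by a cubic matrix and a unitary `a`. -/
def actionUnitary (v : Matrix (Fin n) (Fin n) G.A) (a : G.A) (x y : FreePowerZ2 n) : G.A :=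
  coeff v x y * a

/-- The factor aa* = 1 appears in every term, so the action does not see the unitary a. -/
theorem adjointCoeff_actionUnitary {v : Matrix (Fin n) (Fin n) G.A} (hv : IsCubic v) {a : G.A}
    (ha : a ∈ unitary G.A) (γ x y : FreePowerZ2 n) :
    adjointCoeff (actionUnitary v a) γ x y = coeff v (x * y⁻¹) γ := by
  refine HasSum.tsum_eq ?_
  refine (hv.hasSum_coeff_mul_star_coeff γ x y).congr_fun fun z => ?_
  rw [actionUnitary, actionUnitary, star_mul, mul_assoc, ← mul_assoc a,
    Unitary.mul_star_self_of_mem ha, one_mul]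

/-- The bicommutant condition holds because the entries of α(γ) depend on xy⁻¹ only and vanish off
one sphere: a slice of α(γ) is a finite combination of left translations. -/
theorem isOrientationPreserving_actionUnitary {v : Matrix (Fin n) (Fin n) G.A} (hv : IsCubic v)
    (hΔ : ∀ i k, G.Δ (v i k) = ∑ l, G.j (v i l ⊗ₜ[ℂ] v l k)) {a : G.A} (ha : a ∈ unitary G.A)
    (hΔa : G.Δ a = G.j (a ⊗ₜ[ℂ] a)) :
    IsOrientationPreserving (Set.range (gen (n := n))) G (actionUnitary v a) where
  unitary :=
    { star_mul_self := fun x y => by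
        let _ := Classical.propDecidable (x = y)
        have := ((hv.hasSum_star_coeff_mul x y).mul_left (star a)).mul_right a
        have h : star a * (if x = y then 1 else 0) * a = if x = y then 1 else 0 := by
          split_ifs <;> simp [Unitary.star_mul_self_of_mem ha]
        rw [h] at this
        refine this.congr_fun fun z => ?_
        simp [actionUnitary, mul_assoc]
      mul_star_self := fun x y => by
        let _ := Classical.propDecidable (x = y)
        refine (hv.hasSum_coeff_mul_star x y).congr_fun fun z => ?_
        rw [actionUnitary, actionUnitary, star_mul, mul_assoc, ← mul_assoc a,
          Unitary.mul_star_self_of_mem ha, one_mul]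
      comul := fun x y => by
        rw [actionUnitary, map_mul, hΔa]
        refine ((hasSum_comul_coeff hv G.j G.Δ hΔ x y).mul_right _).congr_fun fun z => ?_
        rw [← map_mul, Algebra.TensorProduct.tmul_mul_tmul]
        rfl }
  commutes x y := by
    by_cases h : (red x).length = (red y).length
    · rw [wordLength_eq, wordLength_eq, h]
    · simp [actionUnitary, coeff_eq_zero v h]
  bicommutant φ γ := by
    obtain ⟨L, hL, h⟩ := exists_mem_bicommutant (fun x => φ (coeff v x γ))
      (finite_length_red_eq (red γ).length).toFinset fun x hx => by
        rw [coeff_eq_zero v (by simpa using hx), map_zero]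
    refine ⟨L, hL, fun x y => ?_⟩
    rw [h, adjointCoeff_actionUnitary hv ha]

end Action
end
end QuantumIsometry

namespace QuantumIsometry
noncomputable section

/-! ### The structure of the orientation preserving actions -/

namespace IsOrientationPreserving

variable {n : ℕ} {G : CompactQuantumGroup.{u}} {U : FreePowerZ2 n → FreePowerZ2 n → G.A}
  (h : IsOrientationPreserving (Set.range gen) G U)

include h

theorem apply_eq_zero {x y : FreePowerZ2 n} (hxy : (red x).length ≠ (red y).length) :
    U x y = 0 := by
  have h1 := h.commutes x y
  rw [wordLength_eq, wordLength_eq, ← sub_eq_zero, ← sub_smul, smul_eq_zero, sub_eq_zero] at h1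
  exact h1.resolve_left fun h2 => hxy (by exact_mod_cast h2.symm)

theorem apply_one_of_ne {x : FreePowerZ2 n} (hx : x ≠ 1) : U x 1 = 0 :=
  h.apply_eq_zero (by rwa [red_one, List.length_nil, Ne, length_red_eq_zero_iff])

theorem one_apply_of_ne {x : FreePowerZ2 n} (hx : x ≠ 1) : U 1 x = 0 :=
  h.apply_eq_zero (by rw [red_one, List.length_nil, ne_comm, Ne, length_red_eq_zero_iff]; exact hx)

theorem apply_gen_eq_zero {x : FreePowerZ2 n} (hx : ∀ k, x ≠ gen k) (i : Fin n) :
    U x (gen i) = 0 :=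
  h.apply_eq_zero fun h' => by
    rw [red_gen, List.length_singleton, length_red_eq_one_iff] at h'
    obtain ⟨k, hk⟩ := h'
    exact hx k hk

theorem gen_apply_eq_zero {x : FreePowerZ2 n} (hx : ∀ k, x ≠ gen k) (i : Fin n) :
    U (gen i) x = 0 :=
  h.apply_eq_zero fun h' => by
    rw [red_gen, List.length_singleton, eq_comm, length_red_eq_one_iff] at h'
    obtain ⟨k, hk⟩ := h'
    exact hx k hk

omit h in
theorem eq_sum_gen_of_hasSum {B : Type*} [AddCommMonoid B] [TopologicalSpace B] [T2Space B]
    {f : FreePowerZ2 n → B} {b : B} (hf : HasSum f b) (h0 : ∀ x, (∀ k, x ≠ gen k) → f x = 0) :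
    b = ∑ k, f (gen k) := by
  classical
  rw [← Finset.sum_image (f := f) (s := Finset.univ) (g := gen) fun i _ k _ hik => gen_injective hik]
  refine hf.unique (hasSum_sum_of_ne_finset_zero fun x hx => h0 x fun k hk => hx ?_)
  simp [hk]

/-- The kernel of D is spanned by δ_1, so the row and the column of 1 have a single nonzero entry.
-/
theorem one_one_mem_unitary : U 1 1 ∈ _root_.unitary G.A := by
  rw [Unitary.mem_iff]
  constructor
  · have h1 := h.unitary.star_mul_self 1 1
    rw [if_pos rfl] at h1
    refine (hasSum_single 1 fun z hz => ?_).unique h1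
    rw [h.apply_one_of_ne hz, mul_zero]
  · have h1 := h.unitary.mul_star_self 1 1
    rw [if_pos rfl] at h1
    refine (hasSum_single 1 fun z hz => ?_).unique h1
    rw [h.one_apply_of_ne hz, zero_mul]

theorem adjointCoeff_one (γ x : FreePowerZ2 n) :
    adjointCoeff U γ x 1 = U x γ * star (U 1 1) := by
  rw [adjointCoeff, tsum_eq_single 1 fun z hz => by rw [h.one_apply_of_ne hz, star_zero, mul_zero],
    mul_one]

/-- Elements of the bicommutant commute with right translations, and bounded functionals separate
the points of C(G). -/
theorem adjointCoeff_mul (γ x y z : FreePowerZ2 n) :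
    adjointCoeff U γ (x * z) (y * z) = adjointCoeff U γ x y := by
  refine (SeparatingDual.eq_iff_forall_dual_eq (R := ℂ)).2 fun φ => ?_
  obtain ⟨L, hL, hφ⟩ := h.bicommutant φ γ
  have h1 := hφ (x * z) (y * z)
  rw [inner_delta_left, bicommutant_apply_mul hL, ← inner_delta_left, hφ] at h1
  exact h1.symm

/-- Translate y to 1, where the defining series has one term. -/
theorem adjointCoeff_eq (γ x y : FreePowerZ2 n) :
    adjointCoeff U γ x y = U (x * y⁻¹) γ * star (U 1 1) := by
  rw [← h.adjointCoeff_one, ← h.adjointCoeff_mul γ x y y⁻¹, mul_inv_cancel]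

omit h in
theorem star_adjointCoeff (γ x y : FreePowerZ2 n) :
    star (adjointCoeff U γ x y) = adjointCoeff U γ⁻¹ y x := by
  rw [adjointCoeff, adjointCoeff, tsum_star,
    ← (Equiv.mulLeft γ).tsum_eq fun z => U y (γ⁻¹ * z) * star (U x z)]
  refine tsum_congr fun z => ?_
  simp

/-- The multiplicativity of the action. -/
theorem apply_gen_mul (i : Fin n) (x y : FreePowerZ2 n) :
    U x (gen i * y) = ∑ k, U (gen k) (gen i) * star (U 1 1) * U (gen k * x) y := by
  classical
  let F := (finite_length_red_eq (n := n) (red y).length).toFinset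
  have hF : ∀ z, z ∉ F → (red z).length ≠ (red y).length := fun z hz => by simpa [F] using hz
  have h1 : ∀ z ∈ F, adjointCoeff U (gen i) x z = ∑ w ∈ F, U x (gen i * w) * star (U z w) := by
    intro z hz
    have hz' : (red z).length = (red y).length := by simpa [F] using hz
    refine tsum_eq_sum fun w hw => ?_
    rw [h.apply_eq_zero fun hzw => hF w hw (hzw.symm.trans hz'), star_zero, mul_zero]
  have h2 : ∀ w, ∑ z ∈ F, star (U z w) * U z y = if w = y then 1 else 0 := by
    intro w
    refine (hasSum_sum_of_ne_finset_zero fun z hz => ?_).unique (by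
      convert h.unitary.star_mul_self w y)
    rw [h.apply_eq_zero (hF z hz), mul_zero]
  -- The relation α(g_i)U = U(g_i ⊗ 1), from U*U = 1 on the sphere of y.
  have h3 : ∑ z ∈ F, adjointCoeff U (gen i) x z * U z y = U x (gen i * y) := by
    rw [Finset.sum_congr rfl fun z hz => by rw [h1 z hz, Finset.sum_mul], Finset.sum_comm]
    simp_rw [mul_assoc, ← Finset.mul_sum, h2]
    simp [F]
  have h4 : ∑ z ∈ F, adjointCoeff U (gen i) x z * U z y
      = ∑' z, adjointCoeff U (gen i) x z * U z y := by
    refine (tsum_eq_sum fun z hz => ?_).symm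
    rw [h.apply_eq_zero (hF z hz), mul_zero]
  have hinj : Function.Injective fun k : Fin n => gen k * x :=
    (mul_left_injective x).comp gen_injective
  -- The same product evaluated otherwise: the entry of α(g_i) at (x, z) vanishes unless xz⁻¹ is a
  -- generator g_k, that is z = g_k x.
  have h5 : ∑' z, adjointCoeff U (gen i) x z * U z y
      = ∑ z ∈ Finset.univ.image (fun k : Fin n => gen k * x),
        adjointCoeff U (gen i) x z * U z y := by
    refine tsum_eq_sum fun z hz => ?_
    rw [h.adjointCoeff_eq, h.apply_gen_eq_zero (fun k hk => hz ?_), zero_mul, zero_mul]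
    have : z = gen k * x := by
      rw [mul_inv_eq_iff_eq_mul] at hk
      rw [hk, gen_mul_gen_mul]
    simp [this]
  rw [← h3, h4, h5, Finset.sum_image fun a _ b _ hab => hinj hab]
  refine Finset.sum_congr rfl fun k _ => ?_
  rw [h.adjointCoeff_eq]
  simp

omit h in
/-- The matrix of the action on the generators. -/
def genMatrix (U : FreePowerZ2 n → FreePowerZ2 n → G.A) : Matrix (Fin n) (Fin n) G.A :=
  fun k i => U (gen k) (gen i) * star (U 1 1)

theorem star_one_one_mul_cancel (b : G.A) : star (U 1 1) * (U 1 1 * b) = b := by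
  rw [← mul_assoc, Unitary.star_mul_self_of_mem h.one_one_mem_unitary, one_mul]

theorem isCubic_genMatrix : IsCubic (genMatrix U) := by
  have hstar : ∀ k i, star (genMatrix U k i) = genMatrix U k i := by
    intro k i
    rw [genMatrix, ← h.adjointCoeff_one, star_adjointCoeff, h.adjointCoeff_eq,
      h.adjointCoeff_one]
    simp
  refine IsCubic.of_col hstar (fun i k => ?_) (fun i k => ?_) fun i k l hkl => ?_
  · have h1 := eq_sum_gen_of_hasSum (h.unitary.mul_star_self (gen i) (gen k)) fun x hx => by
      rw [h.gen_apply_eq_zero hx, zero_mul]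
    simp only [gen_injective.eq_iff] at h1
    convert h1.symm using 2 with l
    rw [← hstar k l, genMatrix, genMatrix, star_mul, star_star, mul_assoc,
      h.star_one_one_mul_cancel]
  · have h1 := eq_sum_gen_of_hasSum (h.unitary.star_mul_self (gen i) (gen k)) fun x hx => by
      rw [h.apply_gen_eq_zero hx k, mul_zero]
    simp only [gen_injective.eq_iff] at h1
    have h2 : ∀ l, genMatrix U l i * genMatrix U l k
        = U 1 1 * (star (U (gen l) (gen i)) * U (gen l) (gen k)) * star (U 1 1) := fun l => by
      rw [← hstar l i, genMatrix, genMatrix, star_mul, star_star]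
      simp only [mul_assoc]
    simp_rw [h2, ← Finset.sum_mul, ← Finset.mul_sum, ← h1]
    split_ifs <;> simp [Unitary.mul_star_self_of_mem h.one_one_mem_unitary]
  -- The coefficient of g_k g_l in α(g_i)² = 1. Only the summand m = k survives, since g_m g_k g_l
  -- has length 3 for m ≠ k.
  · have r1 : red (gen k * gen l) = [k, l] := by
      rw [red_gen_mul (by simpa using Ne.symm hkl), red_gen]
    have h1 := h.apply_gen_mul i (gen k * gen l) (gen i)
    rw [gen_mul_self, h.apply_one_of_ne (fun h' => by simp [h'] at r1),
      Finset.sum_eq_single k] at h1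
    · rw [gen_mul_gen_mul] at h1
      rw [genMatrix, genMatrix, ← mul_assoc, ← h1, zero_mul]
    · intro m _ hm
      rw [h.apply_gen_eq_zero (x := gen m * (gen k * gen l)), mul_zero]
      intro j hj
      have r2 := congrArg red hj
      rw [red_gen_mul (by simpa [r1] using Ne.symm hm), r1, red_gen] at r2
      simp at r2
    · simp

/-- After multiplication by a*, U obeys the recursion of `coeff` with the same column at 1. -/
theorem eq_actionUnitary : U = actionUnitary (genMatrix U) (U 1 1) := by
  classical
  have key : ∀ x y, U x y * star (U 1 1) = coeff (genMatrix U) x y := by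
    refine coeff_unique (v := genMatrix U) (fun x => ?_) (fun i x y => ?_)
      h.isCubic_genMatrix.coeff_gen_mul
    · rw [coeff_one]
      split_ifs with hx
      · rw [hx, Unitary.mul_star_self_of_mem h.one_one_mem_unitary]
      · rw [h.apply_one_of_ne hx, zero_mul]
    · rw [h.apply_gen_mul, Finset.sum_mul]
      simp only [genMatrix, mul_assoc]
  funext x y
  rw [actionUnitary, ← key, mul_assoc, Unitary.star_mul_self_of_mem h.one_one_mem_unitary, mul_one]

theorem comul_one_one : G.Δ (U 1 1) = G.j (U 1 1 ⊗ₜ[ℂ] U 1 1) := by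
  refine (h.unitary.comul 1 1).unique (hasSum_single 1 fun z hz => ?_)
  rw [h.apply_one_of_ne hz, TensorProduct.tmul_zero, map_zero]

theorem comul_genMatrix (k i : Fin n) :
    G.Δ (genMatrix U k i) = ∑ l, G.j (genMatrix U k l ⊗ₜ[ℂ] genMatrix U l i) := by
  have h1 := eq_sum_gen_of_hasSum (h.unitary.comul (gen k) (gen i)) fun x hx => by
    rw [h.apply_gen_eq_zero hx, TensorProduct.tmul_zero, map_zero]
  rw [genMatrix, map_mul, map_star, h1, h.comul_one_one, ← map_star, Finset.sum_mul]
  refine Finset.sum_congr rfl fun l _ => ?_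
  rw [← map_mul, TensorProduct.star_tmul, Algebra.TensorProduct.tmul_mul_tmul]
  rfl

end IsOrientationPreserving
end
end QuantumIsometry

namespace QuantumIsometry
noncomputable section

/-! ### The universal quantum groups of cubic matrices -/

/-- The product of two cubic matrices whose entries commute is cubic. -/
theorem IsCubic.mul {B : Type*} [CStarAlgebra B] {n : ℕ} {v w : Matrix (Fin n) (Fin n) B}
    (hv : IsCubic v) (hw : IsCubic w) (hvw : ∀ i k l m, Commute (v i k) (w l m)) :
    IsCubic (v * w) := by
  have comm : ∀ i m k k' m' l, v i m * w m k * (v k' m' * w m' l)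
      = v i m * v k' m' * (w m k * w m' l) := fun i m k k' m' l => by
    rw [mul_assoc, ← mul_assoc (w m k), ← (hvw k' m' m k).eq]
    simp only [mul_assoc]
  have ht : (v * w).transpose = w.transpose * v.transpose := by
    ext i k
    simp_rw [Matrix.transpose_apply, Matrix.mul_apply, Matrix.transpose_apply, (hvw _ _ _ _).eq]
  refine ⟨fun i k => ?_, ?_, ?_, fun i k l hkl => ?_, fun i k l hkl => ?_⟩
  · simp_rw [Matrix.mul_apply, star_sum, star_mul, hv.selfAdjoint, hw.selfAdjoint, (hvw _ _ _ _).eq]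
  · rw [ht, mul_assoc, ← mul_assoc w, hw.mul_transpose, one_mul, hv.mul_transpose]
  · rw [ht, mul_assoc, ← mul_assoc v.transpose, hv.transpose_mul, one_mul, hw.transpose_mul]
  · simp_rw [Matrix.mul_apply, Finset.sum_mul_sum, comm]
    refine Finset.sum_eq_zero fun m _ => Finset.sum_eq_zero fun m' _ => ?_
    rcases eq_or_ne m m' with rfl | hm
    · rw [hw.row m k l hkl, mul_zero]
    · rw [hv.row i m m' hm, zero_mul]
  · simp_rw [Matrix.mul_apply, Finset.sum_mul_sum, comm]
    refine Finset.sum_eq_zero fun m _ => Finset.sum_eq_zero fun m' _ => ?_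
    rcases eq_or_ne m m' with rfl | hm
    · rw [hv.col m k l hkl, zero_mul]
    · rw [hw.col i m m' hm, mul_zero]

/-! ### Comultiplying cubic matrices and unitaries -/

section Legs

variable {A B T : Type*} [CStarAlgebra A] [CStarAlgebra B] [CStarAlgebra T]

/-- The first leg `a ↦ a ⊗ 1`. -/
def leftLeg (j : A ⊗[ℂ] B →⋆ₐ[ℂ] T) : A →⋆ₐ[ℂ] T :=
  j.comp { (Algebra.TensorProduct.includeLeft : A →ₐ[ℂ] A ⊗[ℂ] B) with
    map_star' := fun a => by simp }

/-- The second leg `b ↦ 1 ⊗ b`. -/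
def rightLeg (j : A ⊗[ℂ] B →⋆ₐ[ℂ] T) : B →⋆ₐ[ℂ] T :=
  j.comp { (Algebra.TensorProduct.includeRight : B →ₐ[ℂ] A ⊗[ℂ] B) with
    map_star' := fun a => by simp }

theorem leftLeg_mul_rightLeg (j : A ⊗[ℂ] B →⋆ₐ[ℂ] T) (a : A) (b : B) :
    leftLeg j a * rightLeg j b = j (a ⊗ₜ[ℂ] b) := by
  change j (a ⊗ₜ[ℂ] 1) * j (1 ⊗ₜ[ℂ] b) = _
  rw [← map_mul, Algebra.TensorProduct.tmul_mul_tmul, mul_one, one_mul]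

theorem rightLeg_mul_leftLeg (j : A ⊗[ℂ] B →⋆ₐ[ℂ] T) (a : A) (b : B) :
    rightLeg j b * leftLeg j a = j (a ⊗ₜ[ℂ] b) := by
  change j (1 ⊗ₜ[ℂ] b) * j (a ⊗ₜ[ℂ] 1) = _
  rw [← map_mul, Algebra.TensorProduct.tmul_mul_tmul, mul_one, one_mul]

/-- The matrix is the product of the two copies of v in the commuting legs of the tensor product. -/
theorem IsCubic.comul {n : ℕ} {v : Matrix (Fin n) (Fin n) A} (hv : IsCubic v)
    (j : A ⊗[ℂ] A →⋆ₐ[ℂ] T) : IsCubic fun i k => ∑ l, j (v i l ⊗ₜ[ℂ] v l k) := by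
  let V : Matrix (Fin n) (Fin n) T := fun i k => leftLeg j (v i k)
  let W : Matrix (Fin n) (Fin n) T := fun i k => rightLeg j (v i k)
  have h : IsCubic (V * W) :=
    IsCubic.mul (hv.map (leftLeg j)) (hv.map (rightLeg j)) fun i k l m => by
      rw [Commute, SemiconjBy, leftLeg_mul_rightLeg, rightLeg_mul_leftLeg]
  have he : (fun i k => ∑ l, j (v i l ⊗ₜ[ℂ] v l k)) = V * W := by
    ext i k
    rw [Matrix.mul_apply]
    exact Finset.sum_congr rfl fun l _ => (leftLeg_mul_rightLeg j _ _).symm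
  rw [he]
  exact h

theorem tmul_mem_unitary (j : A ⊗[ℂ] A →⋆ₐ[ℂ] T) {a : A} (ha : a ∈ unitary A) :
    j (a ⊗ₜ[ℂ] a) ∈ unitary T := by
  rw [← leftLeg_mul_rightLeg]
  exact mul_mem (Unitary.map_mem (leftLeg j) ha) (Unitary.map_mem (rightLeg j) ha)

end Legs

/-- `C(G)` is the universal C*-algebra generated by the entries of the cubic matrix `v` and the
unitary `a`, subject to `a = 1` under the assumption `q`; the matrix `v` is a representation and `a`
is group-like. -/
structure IsUniversalCubic {n : ℕ} (q : Prop) (G : CompactQuantumGroup.{u})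
    (v : Matrix (Fin n) (Fin n) G.A) (a : G.A) : Prop where
  isCubic : IsCubic v
  unitary : a ∈ unitary G.A
  eq_one : q → a = 1
  comul : ∀ i k, G.Δ (v i k) = ∑ l, G.j (v i l ⊗ₜ[ℂ] v l k)
  comul_unitary : G.Δ a = G.j (a ⊗ₜ[ℂ] a)
  exists_lift : ∀ (B : Type u) [CStarAlgebra B] (w : Matrix (Fin n) (Fin n) B) (b : B),
    IsCubic w → b ∈ _root_.unitary B → (q → b = 1) →
    ∃ f : G.A →⋆ₐ[ℂ] B, (∀ i k, f (v i k) = w i k) ∧ f a = b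
  hom_ext : ∀ (B : Type u) [CStarAlgebra B] (f f' : G.A →⋆ₐ[ℂ] B),
    (∀ i k, f (v i k) = f' (v i k)) → f a = f' a → f = f'

/-- A generating set for the homomorphisms which has a universal property generates the algebra. -/
theorem topologicalClosure_adjoin_eq_top {A : Type u} [CStarAlgebra A] {s : Set A}
    (lift : ∀ S : StarSubalgebra ℂ A, IsClosed (S : Set A) → s ⊆ S →
      ∃ f : A →⋆ₐ[ℂ] A, (∀ x, f x ∈ S) ∧ ∀ x ∈ s, f x = x)
    (ext : ∀ f f' : A →⋆ₐ[ℂ] A, (∀ x ∈ s, f x = f' x) → f = f') :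
    (StarAlgebra.adjoin ℂ s).topologicalClosure = ⊤ := by
  obtain ⟨f, hf, hfs⟩ := lift _ (StarSubalgebra.isClosed_topologicalClosure _)
    ((StarAlgebra.subset_adjoin ℂ s).trans (StarSubalgebra.le_topologicalClosure _))
  -- The map f fixes the generators, hence is the identity by uniqueness, while its values lie in
  -- the closed subalgebra.
  refine StarSubalgebra.eq_top_iff.2 fun x => ?_
  have h := hf x
  rwa [ext f (.id ℂ A) hfs] at h

/-- Universality produces Δ, and v and the 1 × 1 matrix (a) are finite-dimensional representations
whose entries generate. -/
theorem exists_isUniversalCubic (n : ℕ) (q : Prop) :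
    ∃ (G : CompactQuantumGroup.{u}) (v : Matrix (Fin n) (Fin n) G.A) (a : G.A),
      IsUniversalCubic q G v a := by
  obtain ⟨A, _, v, a, _, hv, ha, hq, lift, ext⟩ := exists_universal_cubic.{u} n q
  let j := CStarSeminorm.Completion.of (minimalSeminorm A A)
  obtain ⟨Δ, hΔ, hΔa⟩ := lift _ _ (j (a ⊗ₜ[ℂ] a)) (hv.comul j) (tmul_mem_unitary j ha)
    fun h => by rw [hq h, ← Algebra.TensorProduct.one_def, map_one]
  have h1 : IsFiniteRep j Δ v :=
    { comul := hΔ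
      isUnit := ⟨⟨v, v.transpose, hv.mul_transpose, hv.transpose_mul⟩, rfl⟩
      isUnit_transpose := ⟨⟨v.transpose, v, hv.transpose_mul, hv.mul_transpose⟩, rfl⟩ }
  have hu : IsUnit (Matrix.of fun _ _ => a : Matrix (Fin 1) (Fin 1) A) := by
    refine ⟨⟨Matrix.of fun _ _ => a, Matrix.of fun _ _ => star a, ?_, ?_⟩, rfl⟩
    · ext i k
      rw [Subsingleton.elim i k, Matrix.one_apply_eq]
      simp [Matrix.mul_apply, Unitary.mul_star_self_of_mem ha]
    · ext i k
      rw [Subsingleton.elim i k, Matrix.one_apply_eq]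
      simp [Matrix.mul_apply, Unitary.star_mul_self_of_mem ha]
  have h2 : IsFiniteRep j Δ (Matrix.of fun _ _ => a : Matrix (Fin 1) (Fin 1) A) :=
    { comul := fun i k => by simpa using hΔa
      isUnit := hu
      isUnit_transpose := hu }
  have hdense : (StarAlgebra.adjoin ℂ {a : A | ∃ (N : ℕ) (v : Matrix (Fin N) (Fin N) A),
      IsFiniteRep j Δ v ∧ ∃ i k, a = v i k}).topologicalClosure = ⊤ := by
    refine topologicalClosure_adjoin_eq_top (fun S hS hs => ?_) fun f f' h => ?_
    · have : IsClosed (S : Set A) := hS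
      have hvS : ∀ i k, v i k ∈ S := fun i k => hs ⟨n, v, h1, i, k, rfl⟩
      have haS : a ∈ S := hs ⟨1, _, h2, 0, 0, rfl⟩
      -- A closed *-subalgebra is itself a C*-algebra, so the universal property can be applied with
      -- target S.
      have hvS' : IsCubic (fun i k => (⟨v i k, hvS i k⟩ : S)) :=
        IsCubic.of_map S.subtype Subtype.val_injective hv
      obtain ⟨f, hf, hfa⟩ := lift S _ ⟨a, haS⟩ hvS'
        (by
          rw [Unitary.mem_iff]
          exact ⟨Subtype.ext (Unitary.star_mul_self_of_mem ha),
            Subtype.ext (Unitary.mul_star_self_of_mem ha)⟩)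
        fun h => Subtype.ext (hq h)
      have hid : S.subtype.comp f = .id ℂ A :=
        ext _ _ _ (fun i k => by simp [hf]) (by simp [hfa])
      exact ⟨S.subtype.comp f, fun x => (f x).2, fun x _ => by rw [hid]; rfl⟩
    · exact ext _ _ _ (fun i k => h _ ⟨n, v, h1, i, k, rfl⟩) (h _ ⟨1, _, h2, 0, 0, rfl⟩)
  let G : CompactQuantumGroup.{u} :=
    { A := A
      T := (minimalSeminorm A A).Completion
      j := j
      isMinimalTensor := isMinimalTensor_completion
      Δ := Δ
      dense := hdense }
  exact ⟨G, v, a, hv, ha, hq, hΔ, hΔa, lift, ext⟩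

end
end QuantumIsometry

namespace QuantumIsometry
noncomputable section

/-! ### The quantum isometry group -/

open IsOrientationPreserving (genMatrix)

variable {n : ℕ}

theorem IsUniversalCubic.isHyperoctahedral {q : Prop} (hq : q) {G : CompactQuantumGroup.{u}}
    {v : Matrix (Fin n) (Fin n) G.A} {a : G.A} (h : IsUniversalCubic q G v a) :
    IsHyperoctahedral G v where
  isCubic := h.isCubic
  comul := h.comul
  universal B _ w hw := by
    obtain ⟨f, hf, -⟩ := h.exists_lift B w 1 hw (one_mem _) fun _ => rfl
    refine ⟨f, hf, fun f' hf' => h.hom_ext B f' f (fun i k => ?_) ?_⟩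
    · rw [hf, hf']
    · rw [h.eq_one hq, map_one, map_one]

theorem IsHyperoctahedral.hom_ext {G : CompactQuantumGroup.{u}} {v : Matrix (Fin n) (Fin n) G.A}
    (h : IsHyperoctahedral G v) {B : Type u} [CStarAlgebra B] {f f' : G.A →⋆ₐ[ℂ] B}
    (hf : ∀ i k, f (v i k) = f' (v i k)) : f = f' :=
  (h.universal B _ (h.isCubic.map f')).unique hf fun _ _ => rfl

/-- A homomorphism is a Hopf morphism if this can be seen on generators. -/
theorem isHopfMorphism_of_ext {G G' : CompactQuantumGroup.{u}} {f : G.A →⋆ₐ[ℂ] G'.A} (s : Set G.A)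
    (ext : ∀ g g' : G.A →⋆ₐ[ℂ] G'.T, (∀ x ∈ s, g x = g' x) → g = g')
    (h : ∀ F : G.T →⋆ₐ[ℂ] G'.T, (∀ a b, F (G.j (a ⊗ₜ[ℂ] b)) = G'.j (f a ⊗ₜ[ℂ] f b)) →
      ∀ x ∈ s, G'.Δ (f x) = F (G.Δ x)) : IsHopfMorphism f := by
  obtain ⟨F, hF⟩ := G.isMinimalTensor.exists_map G'.isMinimalTensor f f
  exact ⟨F, hF, DFunLike.congr_fun (ext (G'.Δ.comp f) (F.comp G.Δ) (h F hF))⟩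

/-- With q false, homomorphisms out of C(G) are pairs of a cubic matrix and a unitary, and every
orientation preserving U' arises from such a pair. -/
theorem IsUniversalCubic.isUniversalOrientationPreserving {G : CompactQuantumGroup.{u}}
    {v : Matrix (Fin n) (Fin n) G.A} {a : G.A} (h : IsUniversalCubic False G v a) :
    IsUniversalOrientationPreserving (Set.range (gen (n := n))) G (actionUnitary v a) where
  isOrientationPreserving :=
    isOrientationPreserving_actionUnitary h.isCubic h.comul h.unitary h.comul_unitary
  universal G' U' h' := by
    obtain ⟨f, hf, hfa⟩ := h.exists_lift G'.A (genMatrix U') (U' 1 1) h'.isCubic_genMatrix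
      h'.one_one_mem_unitary False.elim
    have hfU : ∀ x y, f (actionUnitary v a x y) = U' x y := fun x y => by
      rw [actionUnitary, map_mul, map_coeff]
      simp_rw [hf, hfa]
      exact (congrFun (congrFun h'.eq_actionUnitary x) y).symm
    refine ⟨f, ⟨?_, hfU⟩, fun f' hf' => ?_⟩
    · refine isHopfMorphism_of_ext (insert a {b | ∃ i k, b = v i k}) (fun g g' hg => ?_)
        fun F hF => ?_
      · exact h.hom_ext _ g g' (fun i k => hg _ (Or.inr ⟨i, k, rfl⟩)) (hg _ (Or.inl rfl))
      · rintro _ (rfl | ⟨i, k, rfl⟩)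
        · rw [hfa, h'.comul_one_one, h.comul_unitary, hF, hfa]
        · simp_rw [hf, h'.comul_genMatrix, h.comul, map_sum, hF, hf]
    -- The entry at (1, 1) is a itself; the entries v_ik a then determine the v_ik by cancelling a.
    · have h1 : f' a = f a := by
        have := (hf'.2 1 1).trans (hfU 1 1).symm
        classical
        rwa [actionUnitary, coeff_one, if_pos rfl, one_mul] at this
      refine h.hom_ext _ f' f (fun i k => ?_) h1
      have h2 := (hf'.2 (gen i) (gen k)).trans (hfU (gen i) (gen k)).symm
      rw [actionUnitary, coeff_gen_gen, map_mul, map_mul, h1] at h2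
      have h3 := congrArg (· * star (f a)) h2
      simpa only [mul_assoc, ← map_star, ← map_mul, Unitary.mul_star_self_of_mem h.unitary,
        map_one, mul_one] using h3

theorem coeff_gen {B : Type*} [Ring B] (v : Matrix (Fin n) (Fin n) B) (i : Fin n)
    {x : FreePowerZ2 n} (hx : ∀ k, x ≠ gen k) : coeff v x (gen i) = 0 :=
  coeff_eq_zero v fun h => by
    rw [red_gen, List.length_singleton, length_red_eq_one_iff] at h
    obtain ⟨k, hk⟩ := h
    exact hx k hk

theorem eq_sum_single {B : Type*} [Ring B] (v : Matrix (Fin n) (Fin n) B) (i : Fin n)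
    {c : FreePowerZ2 n →₀ B} (hc : ∀ x, c x = coeff v x (gen i)) :
    c = ∑ k, Finsupp.single (gen k) (v k i) := by
  classical
  ext x
  rw [hc, Finsupp.finsetSum_apply]
  by_cases hx : ∃ k, x = gen k
  · obtain ⟨k, rfl⟩ := hx
    rw [coeff_gen_gen, Finset.sum_eq_single k, Finsupp.single_eq_same]
    · exact fun l _ hl => Finsupp.single_eq_of_ne fun h => hl (gen_injective h).symm
    · simp
  · push Not at hx
    rw [coeff_gen v i hx, Finset.sum_eq_zero]
    exact fun k _ => Finsupp.single_eq_of_ne (hx k)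

/-- The action of the quantum group of a cubic matrix on the group algebra. -/
def cubicAction {B : Type*} [Ring B] (v : Matrix (Fin n) (Fin n) B) (γ : FreePowerZ2 n) :
    FreePowerZ2 n →₀ B :=
  Finsupp.ofSupportFinite (fun x => coeff v x γ) <|
    (finite_length_red_eq (red γ).length).subset fun x hx => by
      by_contra h
      exact hx (coeff_eq_zero v h)

theorem cubicAction_apply {B : Type*} [Ring B] (v : Matrix (Fin n) (Fin n) B)
    (γ x : FreePowerZ2 n) : cubicAction v γ x = coeff v x γ := rfl

theorem isClosed_map_of_injective {A B : Type*} [CStarAlgebra A] [CStarAlgebra B]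
    {f : A →⋆ₐ[ℂ] B} (hf : Function.Injective f) {S : StarSubalgebra ℂ A}
    (hS : IsClosed (S : Set A)) : IsClosed (S.map f : Set B) :=
  (NonUnitalStarAlgHom.isometry f hf).isClosedEmbedding.isClosedMap _ hS

theorem range_eq_topologicalClosure_adjoin {A B : Type*} [CStarAlgebra A] [CStarAlgebra B]
    {f : A →⋆ₐ[ℂ] B} (hf : Function.Injective f) {s : Set A} {t : Set B}
    (hs : (StarAlgebra.adjoin ℂ s).topologicalClosure = ⊤) (hst : ∀ x ∈ s, f x ∈ t)
    (ht : t ⊆ Set.range f) : f.range = (StarAlgebra.adjoin ℂ t).topologicalClosure := by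
  refine le_antisymm ?_ ?_
  · rintro _ ⟨x, rfl⟩
    let S := ((StarAlgebra.adjoin ℂ t).topologicalClosure).comap f
    have hS : IsClosed (S : Set A) :=
      (StarSubalgebra.isClosed_topologicalClosure _).preimage (continuous_starAlgHom f)
    have h1 : (StarAlgebra.adjoin ℂ s).topologicalClosure ≤ S :=
      StarSubalgebra.topologicalClosure_minimal (StarAlgebra.adjoin_le fun y hy =>
        StarSubalgebra.le_topologicalClosure _ (StarAlgebra.subset_adjoin ℂ _ (hst y hy))) hS
    exact h1 (hs ▸ StarSubalgebra.mem_top)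
  · refine StarSubalgebra.topologicalClosure_minimal (StarAlgebra.adjoin_le ?_) ?_
    · exact fun y hy => ht hy
    · exact (NonUnitalStarAlgHom.isometry f hf).isClosedEmbedding.isClosed_range

theorem IsHyperoctahedral.topologicalClosure_adjoin {G : CompactQuantumGroup.{u}}
    {v : Matrix (Fin n) (Fin n) G.A} (h : IsHyperoctahedral G v) :
    (StarAlgebra.adjoin ℂ {b | ∃ i k, b = v i k}).topologicalClosure = ⊤ := by
  refine topologicalClosure_adjoin_eq_top (fun S hS hs => ?_) fun f f' hf =>
    h.hom_ext fun i k => hf _ ⟨i, k, rfl⟩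
  have : IsClosed (S : Set G.A) := hS
  have hvS : IsCubic (fun i k => (⟨v i k, hs ⟨i, k, rfl⟩⟩ : S)) :=
    IsCubic.of_map S.subtype Subtype.val_injective h.isCubic
  obtain ⟨f, hf, -⟩ := h.universal S _ hvS
  refine ⟨S.subtype.comp f, fun x => (f x).2, ?_⟩
  rintro _ ⟨i, k, rfl⟩
  exact congrArg Subtype.val (hf i k)

/-- C(H_n⁺) maps into the algebra generated by u and a through v ↦ u; the map u ↦ v, a ↦ 1 is a left
inverse, which gives injectivity. The range is right because a is absent from the adjoint
coefficients. -/
theorem IsHyperoctahedral.isQuantumIsometryGroup {G : CompactQuantumGroup.{u}}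
    {v : Matrix (Fin n) (Fin n) G.A} (h : IsHyperoctahedral G v) :
    IsQuantumIsometryGroup (Set.range (gen (n := n))) G (cubicAction v) := by
  obtain ⟨Gt, u, a, hu⟩ := exists_isUniversalCubic.{u} n False
  obtain ⟨f, hf, -⟩ := h.universal Gt.A u hu.isCubic
  obtain ⟨r, hr, -⟩ := hu.exists_lift G.A v 1 h.isCubic (one_mem _) False.elim
  have hrf : r.comp f = .id ℂ G.A := h.hom_ext fun i k => by
    rw [StarAlgHom.comp_apply, hf, hr]
    rfl
  have hinj : Function.Injective f := Function.LeftInverse.injective (DFunLike.congr_fun hrf)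
  have hfc : ∀ x y, f (coeff v x y) = coeff u x y := fun x y => by
    rw [map_coeff]
    simp_rw [hf]
  refine ⟨Gt, actionUnitary u a, hu.isUniversalOrientationPreserving, f, ?_, hinj, ?_, ?_⟩
  · refine isHopfMorphism_of_ext {b | ∃ i k, b = v i k}
      (fun g g' hg => h.hom_ext fun i k => hg _ ⟨i, k, rfl⟩) fun F hF => ?_
    rintro _ ⟨i, k, rfl⟩
    simp_rw [hf, hu.comul, h.comul, map_sum, hF, hf]
  · refine range_eq_topologicalClosure_adjoin hinj h.topologicalClosure_adjoin ?_ ?_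
    · rintro _ ⟨i, k, rfl⟩
      refine ⟨gen k, gen i, 1, ?_⟩
      rw [adjointCoeff_actionUnitary hu.isCubic hu.unitary, inv_one, mul_one, coeff_gen_gen, hf]
    · rintro _ ⟨γ, x, y, rfl⟩
      exact ⟨coeff v (x * y⁻¹) γ, by
        rw [hfc, adjointCoeff_actionUnitary hu.isCubic hu.unitary]⟩
  · intro γ x y
    rw [cubicAction_apply, hfc, adjointCoeff_actionUnitary hu.isCubic hu.unitary]

/-- A universal orientation preserving action has the universal property of a cubic matrix and a
unitary. -/
theorem IsUniversalOrientationPreserving.exists_lift {G : CompactQuantumGroup.{u}}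
    {U : FreePowerZ2 n → FreePowerZ2 n → G.A}
    (h : IsUniversalOrientationPreserving (Set.range (gen (n := n))) G U)
    {B : Type u} [CStarAlgebra B] {w : Matrix (Fin n) (Fin n) B} (hw : IsCubic w) :
    ∃ g : G.A →⋆ₐ[ℂ] B, ∀ i k, g (genMatrix U i k) = w i k := by
  classical
  obtain ⟨Gt, u, a, hu⟩ := exists_isUniversalCubic.{u} n False
  obtain ⟨f, ⟨-, hf⟩, -⟩ := h.universal Gt _
    hu.isUniversalOrientationPreserving.isOrientationPreserving
  -- Pass to the explicit model, then send its unitary to 1.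
  obtain ⟨g, hg, -⟩ := hu.exists_lift B w 1 hw (one_mem _) False.elim
  refine ⟨g.comp f, fun i k => ?_⟩
  rw [StarAlgHom.comp_apply, genMatrix, map_mul, map_star, hf, hf, actionUnitary, actionUnitary,
    coeff_gen_gen, coeff_one, if_pos rfl, one_mul, mul_assoc,
    Unitary.mul_star_self_of_mem hu.unitary, mul_one, hg]

theorem IsQuantumIsometryGroup.exists_isHyperoctahedral {G : CompactQuantumGroup.{u}}
    {α : FreePowerZ2 n → (FreePowerZ2 n →₀ G.A)}
    (h : IsQuantumIsometryGroup (Set.range (gen (n := n))) G α) :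
    ∃ v : Matrix (Fin n) (Fin n) G.A,
      (∀ i, α (gen i) = ∑ k, Finsupp.single (gen k) (v k i)) ∧ IsHyperoctahedral G v := by
  obtain ⟨Gt, U, hU, f, ⟨F, hF, hFΔ⟩, hinj, hrange, hα⟩ := h
  have hO := hU.isOrientationPreserving
  let v : Matrix (Fin n) (Fin n) G.A := fun k i => α (gen i) (gen k)
  have hadj : ∀ γ x y, adjointCoeff U γ x y = coeff (genMatrix U) (x * y⁻¹) γ := fun γ x y => by
    have h1 := adjointCoeff_actionUnitary hO.isCubic_genMatrix hO.one_one_mem_unitary γ x y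
    rwa [← hO.eq_actionUnitary] at h1
  have hfα : ∀ γ x, f (α γ x) = coeff (genMatrix U) x γ := fun γ x => by
    have h1 := hα γ x 1
    rw [hadj, inv_one, mul_one] at h1
    exact h1.symm
  have hfv : ∀ k i, f (v k i) = genMatrix U k i := fun k i => by
    rw [hfα, coeff_gen_gen]
  have hfc : ∀ x y, f (coeff v x y) = coeff (genMatrix U) x y := fun x y => by
    rw [map_coeff]
    simp_rw [hfv]
  have hv : IsCubic v := IsCubic.of_map f hinj (by simp_rw [hfv]; exact hO.isCubic_genMatrix)
  have hext : ∀ (B : Type u) [CStarAlgebra B] (g g' : G.A →⋆ₐ[ℂ] B),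
      (∀ i k, g (v i k) = g' (v i k)) → g = g' := by
    intro B _ g g' hg
    let E := StarAlgHom.equalizer g g'
    have hE : IsClosed (E : Set G.A) :=
      isClosed_eq (continuous_starAlgHom g) (continuous_starAlgHom g')
    -- The adjoint coefficients are images of words in v, on which g and g' agree, and the image of
    -- the closed equalizer is closed.
    have h1 : f.range ≤ E.map f := by
      rw [hrange]
      refine StarSubalgebra.topologicalClosure_minimal (StarAlgebra.adjoin_le ?_)
        (isClosed_map_of_injective hinj hE)
      rintro _ ⟨γ, x, y, rfl⟩
      refine ⟨coeff v (x * y⁻¹) γ, ?_, by rw [hadj]; exact hfc _ _⟩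
      change g _ = g' _
      simp_rw [map_coeff, hg]
    refine DFunLike.ext _ _ fun x => ?_
    obtain ⟨y, hy, hyx⟩ := h1 ⟨x, rfl⟩
    exact hinj hyx ▸ hy
  -- A retraction of f. Its tensor square retracts F, so the comultiplication formula known in `Gt`
  -- can be carried back to G.
  obtain ⟨r, hr⟩ := hU.exists_lift hv
  have hrf : ∀ i k, r (f (v i k)) = v i k := fun i k => by rw [hfv, hr]
  obtain ⟨R, hR⟩ := Gt.isMinimalTensor.exists_map G.isMinimalTensor r r
  have hrf' : r.comp f = .id ℂ G.A := hext _ _ _ hrf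
  have hRF : R.comp F = .id ℂ G.T := G.isMinimalTensor.hom_ext fun a b => by
    rw [StarAlgHom.comp_apply, hF, hR]
    exact congrArg₂ (fun a b => G.j (a ⊗ₜ[ℂ] b)) (DFunLike.congr_fun hrf' a)
      (DFunLike.congr_fun hrf' b)
  refine ⟨v, fun i => eq_sum_single v i fun x => hinj ?_, hv, fun B _ w hw => ?_, fun i k => ?_⟩
  · rw [hfα, hfc]
  · obtain ⟨g, hg⟩ := hU.exists_lift hw
    have hgf : ∀ i k, g.comp f (v i k) = w i k := fun i k => by
      rw [StarAlgHom.comp_apply, hfv, hg]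
    exact ⟨g.comp f, hgf, fun g' hg' => hext _ _ _ fun i k => by rw [hg', hgf]⟩
  · have h1 := DFunLike.congr_fun hRF (G.Δ (v i k))
    rw [StarAlgHom.comp_apply, ← hFΔ, hfv, hO.comul_genMatrix, map_sum] at h1
    change _ = G.Δ (v i k) at h1
    rw [← h1]
    simp_rw [hR, hr]

end
end QuantumIsometry

theorem proposition6p1 (n : ℕ) :
    -- the hyperoctahedral quantum group `H_n⁺` exists,
    (∃ (G : QuantumIsometry.CompactQuantumGroup.{u}) (v : Matrix (Fin n) (Fin n) G.A),
      QuantumIsometry.IsHyperoctahedral G v) ∧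
    -- it is the quantum isometry group of the dual of `ℤ₂ * ⋯ * ℤ₂`,
    (∀ (G : QuantumIsometry.CompactQuantumGroup.{u}) (v : Matrix (Fin n) (Fin n) G.A),
      QuantumIsometry.IsHyperoctahedral G v →
        ∃ α : QuantumIsometry.FreePowerZ2 n → (QuantumIsometry.FreePowerZ2 n →₀ G.A),
          QuantumIsometry.IsQuantumIsometryGroup (Set.range QuantumIsometry.gen) G α ∧
          ∀ i, α (QuantumIsometry.gen i) =
            ∑ k, Finsupp.single (QuantumIsometry.gen k) (v k i)) ∧
    -- and conversely the quantum isometry group is the hyperoctahedral quantum group, with the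
    -- generators being the coefficients of the action, which are self-adjoint partial isometries
    -- that satisfy the cubic relations
    (∀ (G : QuantumIsometry.CompactQuantumGroup.{u})
      (α : QuantumIsometry.FreePowerZ2 n → (QuantumIsometry.FreePowerZ2 n →₀ G.A)),
      QuantumIsometry.IsQuantumIsometryGroup (Set.range QuantumIsometry.gen) G α →
        ∃ v : Matrix (Fin n) (Fin n) G.A,
          (∀ i, α (QuantumIsometry.gen i) =
            ∑ k, Finsupp.single (QuantumIsometry.gen k) (v k i)) ∧
          QuantumIsometry.IsHyperoctahedral G v ∧
          ∀ i k, IsSelfAdjoint (v i k) ∧ v i k * star (v i k) * v i k = v i k ∧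
            ∀ l, l ≠ k → v i k * v i l = 0 ∧ v k i * v l i = 0) := by
  open QuantumIsometry in
  refine ⟨?_, fun G v h => ⟨cubicAction v, h.isQuantumIsometryGroup, fun i =>
    eq_sum_single v i fun x => cubicAction_apply v _ x⟩, fun G α h => ?_⟩
  -- With `True` the extra unitary is forced to be 1, and only the cubic matrix remains.
  · obtain ⟨G, v, a, h⟩ := exists_isUniversalCubic n True
    exact ⟨G, v, h.isHyperoctahedral trivial⟩
  · obtain ⟨v, hα, hv⟩ := h.exists_isHyperoctahedral
    refine ⟨v, hα, hv, fun i k => ⟨hv.isCubic.selfAdjoint i k, ?_, fun l hl =>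
      ⟨hv.isCubic.row i k l hl.symm, hv.isCubic.col i k l hl.symm⟩⟩⟩
    rw [hv.isCubic.selfAdjoint]
    exact hv.isCubic.mul_self_mul_self i k
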